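/- Let $\Omega\subset\mathbb{R}^2$ be a bounded, connected, simply connected domain whose boundary is a simple closed piecewise smooth curve (continuous, and consisting of finitely many arcs that are $C^1$ up to their end points). Let $L=|\partial\Omega|$ be its perimeter, fix a reference point on $\partial\Omega$, and parametrize $\partial\Omega$ by the arclength $s\in[0,L)$ in the positive direction ($\Omega$ on the left). Let $\Phi=\{(s,\theta): 0\le s<L,\ 0\le\theta\le\pi\}$ be the phase space of the billiard map, where $\theta$ is the angle from the positive tangent at the boundary point $s$ to the outgoing velocity, and let $\nu$ be the Liouville measure, $d\nu=\sin\theta\,ds\,d\theta$. The billiard map $\varphi$ sends $(s,\theta)$ to $(s',\theta')$, where $s'$ is the first boundary point that is hit by a ball leaving $s$ in the direction $\theta$ and $\theta'$ gives its direction after the elastic reflection there; it is defined if $s$ and $s'$ are not corners and the velocities there are not tangent to $\partial\Omega$. For $z=(s,\theta)$ with $\varphi(z)=(s',\theta')$ let $\xi(z)\in[0,L)$ be the number with $s+\xi(z)=s'$ or $s+\xi(z)=s'+L$. The rotation number of $z$ is $$\rho(z)=\frac1L\lim_{n\to\infty}\frac1n\sum_{k=0}^{n-1}\xi(\varphi^k(z)),$$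 defined if the whole forward orbit of $z$ is defined and the limit exists. Then $\rho(z)$ exists for $\nu$-almost every $z\in\Phi$, and: 1. For every Borel set $X\subset[0,1]$, with $1-X=\{1-x: x\in X\}$, the sets $\rho^{-1}(X)$ and $\rho^{-1}(1-X)$ are measurable subsets of $\Phi$, and $\nu(\rho^{-1}(X))=\nu(\rho^{-1}(1-X))$. 2. $\rho$ is $\nu$-integrable and $$\frac{\int_\Phi\rho\,d\nu}{\nu(\Phi)}=\frac12 .$$ 3. If the billiard in $\Omega$ is ergodic, i.e. every $\varphi$-invariant measurable set is $\nu$-null or has $\nu$-null complement, then $\rho(z)=\frac12$ for $\nu$-almost every $z\in\Phi$. -/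

import Mathlib

noncomputable section

namespace PlanarBilliard

open Set Filter Topology MeasureTheory

/-- `γ` is a positively oriented arclength parametrization, of total length `L`, of the boundary
of the plane domain `Ω`, and this boundary is a simple closed piecewise smooth curve.
The curve is written as an `L`-periodic function on the line, i.e. as a function on `ℝ / Lℤ`.
Outside finitely many vertices the curve is `C¹`, and each arc between vertices is `C¹` up to and
including its end points; the vertices may be corners of any angle, including cusps. -/
structure IsBoundaryParam (Ω : Set ℂ) (L : ℝ) (γ : ℝ → ℂ) : Prop where
  perimeter_pos : 0 < L
  periodic : Function.Periodic γ L
  continuous : Continuous γ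
  /-- the closed curve is simple -/
  injOn : InjOn γ (Ico 0 L)
  range_eq : range γ = frontier Ω
  piecewise_smooth : ∃ vertices : Set ℂ, vertices.Finite ∧
    ∀ a b : ℝ, a < b → (∀ s ∈ Ioo a b, γ s ∉ vertices) → ContDiffOn ℝ 1 γ (Icc a b)
  /-- `s` is the arclength -/
  unit_speed : ∀ s, ContDiffAt ℝ 1 γ s → ‖deriv γ s‖ = 1
  /-- positive orientation: at every smooth boundary point the domain lies on the left of the
  curve, and not on its right -/
  positively_oriented : ∀ s, ContDiffAt ℝ 1 γ s → ∀ᶠ ε : ℝ in 𝓝[>] 0,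
    γ s + ε * (Complex.I * deriv γ s) ∈ Ω ∧ γ s - ε * (Complex.I * deriv γ s) ∉ Ω

/-- The phase space `Φ` of the billiard map in the standard coordinates `(s, θ)`: `s` is the
arclength coordinate of the footpoint, `θ` the angle from the positive tangent to the outgoing
velocity. -/
def phaseSpace (L : ℝ) : Set (ℝ × ℝ) := Ico 0 L ×ˢ Icc 0 Real.pi

/-- The Liouville measure `dν = sin θ ds dθ` on the phase space. -/
def liouville (L : ℝ) : Measure (ℝ × ℝ) :=
  (volume.restrict (phaseSpace L)).withDensity fun z => ENNReal.ofReal (Real.sin z.2)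

/-- Phase points with a smooth footpoint and a velocity that is not tangent to the boundary. -/
def smoothPhase (L : ℝ) (γ : ℝ → ℂ) : Set (ℝ × ℝ) :=
  {z | z.1 ∈ Ico 0 L ∧ ContDiffAt ℝ 1 γ z.1 ∧ z.2 ∈ Ioo 0 Real.pi}

/-- The outgoing unit velocity at the phase point `(s, θ)`. -/
def outVelocity (γ : ℝ → ℂ) (z : ℝ × ℝ) : ℂ :=
  deriv γ z.1 * Complex.exp (z.2 * Complex.I)

/-- The unit velocity with which a ball arrives at the footpoint of `(s, θ)` if its velocity
after the elastic reflection there is the outgoing velocity of `(s, θ)`: the mirror image of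
the latter in the tangent line. -/
def inVelocity (γ : ℝ → ℂ) (z : ℝ × ℝ) : ℂ :=
  deriv γ z.1 * Complex.exp (-(z.2 * Complex.I))

/-- One step of the billiard: the ball leaves the footpoint of `z` with the outgoing velocity
of `z`, moves freely inside `Ω` until it hits the boundary for the first time, at the footpoint of
`w`, and is reflected there by the law that the angle of incidence equals the angle of
reflection. For given `z` there is at most one such `w`; there is none if the ball runs into a
vertex or hits the boundary tangentially. -/
def Step (Ω : Set ℂ) (L : ℝ) (γ : ℝ → ℂ) (z w : ℝ × ℝ) : Prop :=
  z ∈ smoothPhase L γ ∧ w ∈ smoothPhase L γ ∧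
    (∃ t : ℝ, 0 < t ∧ γ w.1 = γ z.1 + t * outVelocity γ z ∧
      ∀ u ∈ Ioo 0 t, γ z.1 + u * outVelocity γ z ∈ Ω) ∧
    outVelocity γ z = inVelocity γ w

/-- The phase points at which the billiard map is defined. -/
def mapDomain (Ω : Set ℂ) (L : ℝ) (γ : ℝ → ℂ) : Set (ℝ × ℝ) :=
  {z | ∃ w, Step Ω L γ z w}

open Classical in
/-- The billiard map `φ`, extended by the identity to the (null) set of phase points at which it
is not defined. -/
def billiardMap (Ω : Set ℂ) (L : ℝ) (γ : ℝ → ℂ) (z : ℝ × ℝ) : ℝ × ℝ :=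
  if h : ∃ w, Step Ω L γ z w then h.choose else z

/-- For arclength coordinates `s₁, s₂ ∈ [0, L)`, the unique `ξ ∈ [0, L)` with `s₁ + ξ = s₂` or
`s₁ + ξ = s₂ + L`. -/
def increment (L s₁ s₂ : ℝ) : ℝ := if s₁ ≤ s₂ then s₂ - s₁ else s₂ + L - s₁

/-- The footpoint increment function `ξ(z)`. -/
def footpointIncrement (Ω : Set ℂ) (L : ℝ) (γ : ℝ → ℂ) (z : ℝ × ℝ) : ℝ :=
  increment L z.1 (billiardMap Ω L γ z).1

/-- The average of the footpoint increments over the first `n` steps of the orbit of `z`. -/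
def averageIncrement (Ω : Set ℂ) (L : ℝ) (γ : ℝ → ℂ) (z : ℝ × ℝ) (n : ℕ) : ℝ :=
  (∑ k ∈ Finset.range n, footpointIncrement Ω L γ ((billiardMap Ω L γ)^[k] z)) / n

/-- The set of phase points whose whole forward orbit is defined and for which the limit that
defines the footpoint gain (equivalently, the rotation number) exists. -/
def rotationDomain (Ω : Set ℂ) (L : ℝ) (γ : ℝ → ℂ) : Set (ℝ × ℝ) :=
  {z | (∀ k : ℕ, (billiardMap Ω L γ)^[k] z ∈ mapDomain Ω L γ) ∧
    ∃ υ : ℝ, Tendsto (averageIncrement Ω L γ z) atTop (𝓝 υ)}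

/-- The footpoint gain `υ(z)`; meaningful for `z ∈ rotationDomain Ω L γ`. -/
def footpointGain (Ω : Set ℂ) (L : ℝ) (γ : ℝ → ℂ) (z : ℝ × ℝ) : ℝ :=
  limUnder atTop (averageIncrement Ω L γ z)

/-- The rotation number `ρ(z) = υ(z) / |∂Ω|`; meaningful for `z ∈ rotationDomain Ω L γ`. -/
def rotationNumber (Ω : Set ℂ) (L : ℝ) (γ : ℝ → ℂ) (z : ℝ × ℝ) : ℝ :=
  footpointGain Ω L γ z / L

/-- The preimage `ρ⁻¹(X)`: the phase points that have a rotation number, lying in `X`. -/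
def rotationPreimage (Ω : Set ℂ) (L : ℝ) (γ : ℝ → ℂ) (X : Set ℝ) : Set (ℝ × ℝ) :=
  {z | z ∈ rotationDomain Ω L γ ∧ rotationNumber Ω L γ z ∈ X}

/-- The billiard in `Ω` is ergodic: every Borel set of phase points that is invariant under the
billiard map is `ν`-null or has a `ν`-null complement. (That the billiard map preserves `ν` is not
part of this condition.) -/
def IsErgodicBilliard (Ω : Set ℂ) (L : ℝ) (γ : ℝ → ℂ) : Prop :=
  PreErgodic (billiardMap Ω L γ) (liouville L)

end PlanarBilliard

end

/-!
Fix a unit vector `v` and consider the stream of balls with velocity `v`. The flux of this stream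
through a part of the boundary is the length of its projection along `v`, counted with
multiplicity. By the area formula, it depends only on which lines parallel to `v` meet that part,
and how often. The billiard map followed by the reversal of the velocity moves each footpoint along
its line, injectively, and therefore preserves the flux. It is defined at flux-almost every
footpoint: a ball which enters the bounded set `Ω` hits the boundary, and by Sard's theorem the
lines through a vertex or a point of tangency project to a null set. In polar coordinates for the
velocity, `ν` is the integral of the flux over all directions `v`, so the billiard map `φ` is
almost everywhere defined and preserves `ν`.

By Birkhoff's theorem, the averages of the increment `ξ` converge almost everywhere. Let `R` be the
reversal `(s, θ) ↦ (s, π - θ)`. A ball sent back retraces its trajectory, so `φ ∘ R ∘ φ = R` and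
`ξ ∘ R ∘ φ = L - ξ`: the average of `ξ` over the first `n` steps from `R (φⁿ z)` is `L` minus the
one from `z`. Since `R ∘ φⁿ` preserves `ν`, these averages, and hence their limits, are distributed
symmetrically about `L / 2`.
-/

namespace PlanarBilliard

open Set Filter Topology MeasureTheory ComplexConjugate

/-! ### Birkhoff's ergodic theorem -/

section Birkhoff

variable {X : Type*} {T : X → X} {g : X → ℝ}

/-- The running maximum of the Birkhoff sums of `g` of length at most `n`, the empty sum included.
The recursive form is the one in which the maximal ergodic theorem is a one-step comparison. -/
def maxBirkhoffSum (T : X → X) (g : X → ℝ) : ℕ → X → ℝ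
  | 0, _ => 0
  | n + 1, x => max 0 (g x + maxBirkhoffSum T g n (T x))

theorem maxBirkhoffSum_nonneg (n : ℕ) (x : X) : 0 ≤ maxBirkhoffSum T g n x := by
  cases n with
  | zero => exact le_rfl
  | succ n => exact le_max_left _ _

theorem monotone_maxBirkhoffSum : Monotone (maxBirkhoffSum T g) := by
  refine monotone_nat_of_le_succ fun n ↦ ?_
  induction n with
  | zero => exact fun x ↦ maxBirkhoffSum_nonneg 1 x
  | succ n ih => exact fun x ↦ max_le_max le_rfl (add_le_add_right (ih (T x)) _)

theorem birkhoffSum_le_maxBirkhoffSum (n : ℕ) (x : X) :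
    birkhoffSum T g n x ≤ maxBirkhoffSum T g n x := by
  induction n generalizing x with
  | zero => exact le_rfl
  | succ n ih =>
    rw [birkhoffSum_succ']
    exact le_max_of_le_right (add_le_add_right (ih (T x)) _)

theorem maxBirkhoffSum_succ_sub_le (n : ℕ) (x : X) :
    maxBirkhoffSum T g (n + 1) x - maxBirkhoffSum T g n (T x) ≤
      {y | 0 < maxBirkhoffSum T g (n + 1) y}.indicator g x := by
  rw [sub_le_iff_le_add]
  by_cases hx : 0 < maxBirkhoffSum T g (n + 1) x
  · rw [indicator_of_mem (show x ∈ {y | 0 < maxBirkhoffSum T g (n + 1) y} from hx)]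
    exact max_le ((lt_max_iff.1 hx).resolve_left (lt_irrefl _)).le le_rfl
  · rw [indicator_of_notMem (show x ∉ {y | 0 < maxBirkhoffSum T g (n + 1) y} from hx), zero_add]
    exact (not_lt.1 hx).trans (maxBirkhoffSum_nonneg n (T x))

/-- The upper time average of `g` along the orbit of `x`. It takes values in `EReal`, so that it is
meaningful, and exactly invariant under `T`, for every function `g`. -/
noncomputable def upperBirkhoffAverage (T : X → X) (g : X → ℝ) (x : X) : EReal :=
  limsup (fun n ↦ ((birkhoffAverage ℝ T g n x : ℝ) : EReal)) atTop

theorem limsup_coe_le_limsup_coe_of_affine {u v a b : ℕ → ℝ} (ha : Tendsto a atTop (𝓝 1))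
    (hb : Tendsto b atTop (𝓝 0)) (ha₀ : ∀ n, 0 ≤ a n) (hv : ∀ᶠ n in atTop, v n = a n * u n + b n) :
    limsup (fun n ↦ (u n : EReal)) atTop ≤ limsup (fun n ↦ (v n : EReal)) atTop := by
  refine EReal.ge_of_forall_gt_iff_ge.1 fun c hc ↦ ?_
  obtain ⟨d, hcd, hd⟩ := EReal.lt_iff_exists_real_btwn.1 hc
  have hlim : Tendsto (fun n ↦ a n * d + b n) atTop (𝓝 d) := by
    simpa using (ha.mul_const d).add hb
  refine le_limsup_of_frequently_le ?_
  have hu : ∃ᶠ n in atTop, (d : EReal) < u n := frequently_lt_of_lt_limsup (by isBoundedDefault) hd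
  refine (hu.and_eventually
    ((hlim.eventually_const_lt (EReal.coe_lt_coe_iff.1 hcd)).and hv)).mono ?_
  rintro n ⟨hdu, hcn, hvn⟩
  rw [EReal.coe_le_coe_iff, hvn]
  have := mul_le_mul_of_nonneg_left (EReal.coe_lt_coe_iff.1 hdu).le (ha₀ n)
  linarith

theorem upperBirkhoffAverage_comp (T : X → X) (g : X → ℝ) (x : X) :
    upperBirkhoffAverage T g (T x) = upperBirkhoffAverage T g x := by
  have hsucc : limsup (fun n ↦ ((birkhoffAverage ℝ T g (n + 1) x : ℝ) : EReal)) atTop =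
      upperBirkhoffAverage T g x :=
    limsup_nat_add (fun n ↦ ((birkhoffAverage ℝ T g n x : ℝ) : EReal)) 1
  have hinv : Tendsto (fun n : ℕ ↦ (n : ℝ)⁻¹) atTop (𝓝 0) := tendsto_inv_atTop_nhds_zero_nat
  have hinv' : Tendsto (fun n : ℕ ↦ ((n : ℝ) + 1)⁻¹) atTop (𝓝 0) := by
    simpa using tendsto_one_div_add_atTop_nhds_zero_nat (𝕜 := ℝ)
  rw [← hsucc]
  apply le_antisymm
  · refine limsup_coe_le_limsup_coe_of_affine (a := fun n ↦ 1 - ((n : ℝ) + 1)⁻¹)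
      (b := fun n ↦ ((n : ℝ) + 1)⁻¹ * g x) (by simpa using hinv'.const_sub 1)
      (by simpa using hinv'.mul_const (g x)) (fun n ↦ ?_) ?_
    · exact sub_nonneg.2 (inv_le_one_of_one_le₀ (le_add_of_nonneg_left n.cast_nonneg))
    · filter_upwards [eventually_gt_atTop 0] with n hn
      simp only [birkhoffAverage, birkhoffSum_succ', smul_eq_mul]
      push_cast
      field_simp
      ring
  · refine limsup_coe_le_limsup_coe_of_affine (a := fun n ↦ 1 + (n : ℝ)⁻¹)
      (b := fun n ↦ -((n : ℝ)⁻¹ * g x)) (by simpa using hinv.const_add 1)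
      (by simpa using (hinv.mul_const (g x)).neg) (fun n ↦ by positivity) ?_
    filter_upwards [eventually_gt_atTop 0] with n hn
    simp only [birkhoffAverage, birkhoffSum_succ', smul_eq_mul]
    push_cast
    field_simp
    ring

theorem exists_mul_lt_birkhoffSum_of_lt_upperBirkhoffAverage {c : ℝ} {x : X}
    (h : c < upperBirkhoffAverage T g x) : ∃ n : ℕ, n * c < birkhoffSum T g n x := by
  obtain ⟨n, hcn, hn⟩ := ((frequently_lt_of_lt_limsup (by isBoundedDefault) h).and_eventually
    (eventually_gt_atTop 0)).exists
  refine ⟨n, ?_⟩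
  rwa [EReal.coe_lt_coe_iff, birkhoffAverage, smul_eq_mul, lt_inv_mul_iff₀ (Nat.cast_pos.2 hn)]
    at hcn

variable [MeasurableSpace X] {μ : Measure X}

theorem measurable_maxBirkhoffSum (hT : Measurable T) (hg : Measurable g) (n : ℕ) :
    Measurable (maxBirkhoffSum T g n) := by
  induction n with
  | zero => exact measurable_const
  | succ n ih => exact measurable_const.max (hg.add (ih.comp hT))

theorem measurable_birkhoffSum (hT : Measurable T) (hg : Measurable g) (n : ℕ) :
    Measurable (birkhoffSum T g n) :=
  Finset.measurable_sum _ fun k _ ↦ hg.comp (hT.iterate k)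

theorem measurable_birkhoffAverage (hT : Measurable T) (hg : Measurable g) (n : ℕ) :
    Measurable (birkhoffAverage ℝ T g n) :=
  (measurable_birkhoffSum hT hg n).const_smul (n : ℝ)⁻¹

theorem measurable_upperBirkhoffAverage (hT : Measurable T) (hg : Measurable g) :
    Measurable (upperBirkhoffAverage T g) :=
  Measurable.limsup fun n ↦ (measurable_birkhoffAverage hT hg n).coe_real_ereal

theorem integrable_maxBirkhoffSum (hT : MeasurePreserving T μ μ) (hg : Integrable g μ) (n : ℕ) :
    Integrable (maxBirkhoffSum T g n) μ := by
  induction n with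
  | zero => exact integrable_zero _ _ _
  | succ n ih => exact (integrable_zero _ _ _).sup (hg.add (hT.integrable_comp_of_integrable ih))

theorem setIntegral_maxBirkhoffSum_pos_nonneg (hT : MeasurePreserving T μ μ) (hg : Measurable g)
    (hgi : Integrable g μ) (n : ℕ) : 0 ≤ ∫ x in {x | 0 < maxBirkhoffSum T g (n + 1) x}, g x ∂μ := by
  have hM := integrable_maxBirkhoffSum hT hgi
  have hpos : MeasurableSet {x | 0 < maxBirkhoffSum T g (n + 1) x} :=
    measurableSet_lt measurable_const (measurable_maxBirkhoffSum hT.measurable hg _)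
  calc 0 ≤ ∫ x, maxBirkhoffSum T g (n + 1) x ∂μ - ∫ x, maxBirkhoffSum T g n x ∂μ :=
        sub_nonneg.2 (integral_mono (hM n) (hM (n + 1)) (monotone_maxBirkhoffSum n.le_succ))
    _ = ∫ x, maxBirkhoffSum T g (n + 1) x ∂μ - ∫ x, maxBirkhoffSum T g n (T x) ∂μ := by
        rw [← integral_map hT.aemeasurable (hT.map_eq.symm ▸ (hM n).aestronglyMeasurable),
          hT.map_eq]
    _ = ∫ x, (maxBirkhoffSum T g (n + 1) x - maxBirkhoffSum T g n (T x)) ∂μ :=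
        (integral_sub (hM _) (hT.integrable_comp_of_integrable (hM n))).symm
    _ ≤ ∫ x, {y | 0 < maxBirkhoffSum T g (n + 1) y}.indicator g x ∂μ :=
        integral_mono ((hM _).sub (hT.integrable_comp_of_integrable (hM n)))
          (hgi.indicator hpos) (maxBirkhoffSum_succ_sub_le n)
    _ = ∫ x in {x | 0 < maxBirkhoffSum T g (n + 1) x}, g x ∂μ := integral_indicator hpos

theorem integral_nonneg_of_ae_exists_birkhoffSum_pos (hT : MeasurePreserving T μ μ)
    (hg : Measurable g) (hgi : Integrable g μ) (h : ∀ᵐ x ∂μ, ∃ n, 0 < birkhoffSum T g n x) :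
    0 ≤ ∫ x, g x ∂μ := by
  set P : ℕ → Set X := fun n ↦ {x | 0 < maxBirkhoffSum T g (n + 1) x}
  have hP : ∀ n, MeasurableSet (P n) := fun n ↦
    measurableSet_lt measurable_const (measurable_maxBirkhoffSum hT.measurable hg _)
  have hlim : Tendsto (fun n ↦ ∫ x, (P n).indicator g x ∂μ) atTop (𝓝 (∫ x, g x ∂μ)) := by
    refine tendsto_integral_of_dominated_convergence (fun x ↦ ‖g x‖)
      (fun n ↦ (hg.indicator (hP n)).aestronglyMeasurable) hgi.norm
      (fun n ↦ Eventually.of_forall fun x ↦ norm_indicator_le_norm_self _ _) ?_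
    filter_upwards [h] with x ⟨n, hn⟩
    refine tendsto_const_nhds.congr' ?_
    filter_upwards [eventually_ge_atTop n] with m hm
    have hxm : x ∈ P m := hn.trans_le <| (birkhoffSum_le_maxBirkhoffSum n x).trans <|
      monotone_maxBirkhoffSum (hm.trans m.le_succ) x
    exact (indicator_of_mem hxm _).symm
  refine ge_of_tendsto' hlim fun n ↦ ?_
  rw [integral_indicator (hP n)]
  exact setIntegral_maxBirkhoffSum_pos_nonneg hT hg hgi n

theorem mul_measureReal_le_setIntegral_of_lt_upperBirkhoffAverage [IsFiniteMeasure μ]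
    (hT : MeasurePreserving T μ μ) (hg : Measurable g) (hgi : Integrable g μ)
    {E : Set X} (hE : MeasurableSet E) (hTE : T ⁻¹' E = E) {c : ℝ}
    (hc : ∀ x ∈ E, (c : EReal) < upperBirkhoffAverage T g x) :
    c * μ.real E ≤ ∫ x in E, g x ∂μ := by
  have hTr : MeasurePreserving T (μ.restrict E) (μ.restrict E) := by
    simpa only [hTE] using hT.restrict_preimage hE
  have hnonneg : 0 ≤ ∫ x in E, (g x - c) ∂μ := by
    refine integral_nonneg_of_ae_exists_birkhoffSum_pos hTr (hg.sub_const c)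
      (hgi.integrableOn.sub (integrable_const c)) ?_
    filter_upwards [ae_restrict_mem hE] with x hx
    obtain ⟨n, hn⟩ := exists_mul_lt_birkhoffSum_of_lt_upperBirkhoffAverage (hc x hx)
    refine ⟨n, ?_⟩
    simpa [birkhoffSum, Finset.sum_sub_distrib] using hn
  rw [integral_sub hgi.integrableOn (integrable_const c), setIntegral_const, smul_eq_mul] at hnonneg
  linarith

theorem ae_upperBirkhoffAverage_ne_top [IsFiniteMeasure μ] (hT : MeasurePreserving T μ μ)
    (hg : Measurable g) (hgi : Integrable g μ) : ∀ᵐ x ∂μ, upperBirkhoffAverage T g x ≠ ⊤ := by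
  set E := upperBirkhoffAverage T g ⁻¹' {⊤}
  have hbound : ∀ c : ℝ, c * μ.real E ≤ ∫ x in E, g x ∂μ := fun c ↦
    mul_measureReal_le_setIntegral_of_lt_upperBirkhoffAverage hT hg hgi
      (measurable_upperBirkhoffAverage hT.measurable hg (measurableSet_singleton _))
      (by ext x; simp [upperBirkhoffAverage_comp])
      fun x hx ↦ (EReal.coe_lt_top c).trans_eq (mem_singleton_iff.1 hx).symm
  have hE : μ.real E = 0 := by
    by_contra hne
    have := hbound (((∫ x in E, g x ∂μ) + 1) / μ.real E)
    rw [div_mul_cancel₀ _ hne] at this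
    linarith
  exact measure_eq_zero_iff_ae_notMem.1 ((measureReal_eq_zero_iff (measure_ne_top _ _)).1 hE)

theorem measure_birkhoffAverage_oscillation_eq_zero [IsFiniteMeasure μ]
    (hT : MeasurePreserving T μ μ) (hg : Measurable g) (hgi : Integrable g μ) {a b : ℝ}
    (hab : a < b) :
    μ {x | (b : EReal) < upperBirkhoffAverage T g x ∧
      ((-a : ℝ) : EReal) < upperBirkhoffAverage T (-g) x} = 0 := by
  set E := {x | (b : EReal) < upperBirkhoffAverage T g x ∧
    ((-a : ℝ) : EReal) < upperBirkhoffAverage T (-g) x}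
  have hE : MeasurableSet E :=
    (measurableSet_lt measurable_const (measurable_upperBirkhoffAverage hT.measurable hg)).inter
      (measurableSet_lt measurable_const (measurable_upperBirkhoffAverage hT.measurable hg.neg))
  have hTE : T ⁻¹' E = E := by
    ext x
    simp only [E, mem_preimage, mem_ofPred_eq, upperBirkhoffAverage_comp]
  have hb := mul_measureReal_le_setIntegral_of_lt_upperBirkhoffAverage hT hg hgi hE hTE
    fun x hx ↦ hx.1
  have ha := mul_measureReal_le_setIntegral_of_lt_upperBirkhoffAverage hT hg.neg hgi.neg hE hTE
    fun x hx ↦ hx.2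
  simp only [Pi.neg_apply, integral_neg] at ha
  have hnonpos : (b - a) * μ.real E ≤ 0 := by linarith
  exact (measureReal_eq_zero_iff (measure_ne_top _ _)).1 <|
    (nonpos_of_mul_nonpos_right hnonpos (sub_pos.2 hab)).antisymm measureReal_nonneg

theorem ae_exists_tendsto_birkhoffAverage_of_measurable [IsFiniteMeasure μ]
    (hT : MeasurePreserving T μ μ) (hg : Measurable g) (hgi : Integrable g μ) :
    ∀ᵐ x ∂μ, ∃ c, Tendsto (birkhoffAverage ℝ T g · x) atTop (𝓝 c) := by
  have hosc : ∀ᵐ x ∂μ, ∀ a b : ℚ, a < b → ¬ (((b : ℝ) : EReal) < upperBirkhoffAverage T g x ∧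
      ((-a : ℝ) : EReal) < upperBirkhoffAverage T (-g) x) := by
    simp only [ae_all_iff]
    exact fun a b hab ↦ measure_eq_zero_iff_ae_notMem.1
      (measure_birkhoffAverage_oscillation_eq_zero hT hg hgi (Rat.cast_lt.2 hab))
  filter_upwards [hosc, ae_upperBirkhoffAverage_ne_top hT hg hgi,
    ae_upperBirkhoffAverage_ne_top hT hg.neg hgi.neg] with x hx htop hbot
  set u : ℕ → EReal := fun n ↦ ((birkhoffAverage ℝ T g n x : ℝ) : EReal)
  have hliminf : upperBirkhoffAverage T (-g) x = -liminf u atTop := by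
    rw [← EReal.limsup_neg, upperBirkhoffAverage]
    congr with n
    simp [u, birkhoffAverage_neg]
  have hle : limsup u atTop ≤ liminf u atTop := by
    by_contra! hlt
    obtain ⟨a, hau, hal⟩ := EReal.lt_iff_exists_rat_btwn.1 hlt
    obtain ⟨b, hab, hbu⟩ := EReal.lt_iff_exists_rat_btwn.1 hal
    refine hx a b (by exact_mod_cast hab) ⟨hbu, ?_⟩
    rw [hliminf, EReal.coe_neg, EReal.neg_lt_neg_iff]
    exact hau
  have heq : liminf u atTop = limsup u atTop := le_antisymm liminf_le_limsup hle
  rw [hliminf, heq] at hbot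
  refine ⟨(limsup u atTop).toReal, EReal.tendsto_coe.1 ?_⟩
  rw [EReal.coe_toReal (x := limsup u atTop) htop fun h ↦ hbot (by rw [h, EReal.neg_bot])]
  exact tendsto_of_liminf_eq_limsup heq rfl

theorem ae_exists_tendsto_birkhoffAverage [IsFiniteMeasure μ] (hT : MeasurePreserving T μ μ)
    (hg : Integrable g μ) : ∀ᵐ x ∂μ, ∃ c, Tendsto (birkhoffAverage ℝ T g · x) atTop (𝓝 c) := by
  have heq := ae_all_iff.2 fun n ↦
    hT.quasiMeasurePreserving.birkhoffAverage_ae_eq_of_ae_eq ℝ hg.1.ae_eq_mk n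
  filter_upwards [heq, ae_exists_tendsto_birkhoffAverage_of_measurable hT
    hg.1.stronglyMeasurable_mk.measurable (hg.congr hg.1.ae_eq_mk)] with x hx ⟨c, hc⟩
  exact ⟨c, hc.congr fun n ↦ (hx n).symm⟩

end Birkhoff

/-! ### Reversible dynamics -/

section Reversibility

variable {X : Type*} {T R : X → X} {g : X → ℝ}

theorem birkhoffSum_apply_reversed {n : ℕ} {x : X}
    (h : ∀ k < n, T (R (T (T^[k] x))) = R (T^[k] x)) :
    birkhoffSum T g n (R (T^[n] x)) = birkhoffSum T (fun y ↦ g (R (T y))) n x := by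
  induction n with
  | zero => simp only [birkhoffSum_zero]
  | succ n ih =>
    rw [birkhoffSum_succ', birkhoffSum_succ, Function.iterate_succ_apply', h n n.lt_succ_self,
      ih fun k hk ↦ h k (hk.trans n.lt_succ_self), add_comm]

theorem birkhoffAverage_apply_reversed {c : ℝ} {n : ℕ} (hn : n ≠ 0) {x : X}
    (hT : ∀ k < n, T (R (T (T^[k] x))) = R (T^[k] x))
    (hg : ∀ k < n, g (R (T (T^[k] x))) = c - g (T^[k] x)) :
    birkhoffAverage ℝ T g n (R (T^[n] x)) = c - birkhoffAverage ℝ T g n x := by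
  have hsum : birkhoffSum T (fun y ↦ g (R (T y))) n x = n * c - birkhoffSum T g n x := by
    rw [birkhoffSum, Finset.sum_congr rfl fun k hk ↦ hg k (Finset.mem_range.1 hk)]
    simp [birkhoffSum]
  simp only [birkhoffAverage, birkhoffSum_apply_reversed hT, hsum, smul_eq_mul, mul_sub]
  rw [inv_mul_cancel_left₀ (Nat.cast_ne_zero.2 hn)]

variable [MeasurableSpace X] {μ : Measure X}

theorem map_eq_map_of_ae_tendsto {E : Type*} [PseudoEMetricSpace E] [MeasurableSpace E]
    [BorelSpace E] [IsFiniteMeasure μ] {u v : ℕ → X → E} {f h : X → E}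
    (hu : ∀ n, AEMeasurable (u n) μ) (hv : ∀ n, AEMeasurable (v n) μ)
    (hf : ∀ᵐ x ∂μ, Tendsto (u · x) atTop (𝓝 (f x)))
    (hh : ∀ᵐ x ∂μ, Tendsto (v · x) atTop (𝓝 (h x)))
    (huv : ∀ᶠ n in atTop, μ.map (u n) = μ.map (v n)) : μ.map f = μ.map h := by
  refine ext_of_forall_integral_eq_of_IsFiniteMeasure fun φ ↦ ?_
  have hlim : ∀ {w : ℕ → X → E} {k : X → E}, (∀ n, AEMeasurable (w n) μ) →
      (∀ᵐ x ∂μ, Tendsto (w · x) atTop (𝓝 (k x))) →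
      Tendsto (fun n ↦ ∫ y, φ y ∂μ.map (w n)) atTop (𝓝 (∫ y, φ y ∂μ.map k)) := by
    intro w k hw hk
    simp only [integral_map (hw _) φ.continuous.measurable.aestronglyMeasurable,
      integral_map (aemeasurable_of_tendsto_metrizable_ae' hw hk)
        φ.continuous.measurable.aestronglyMeasurable]
    refine tendsto_integral_of_dominated_convergence (fun _ ↦ ‖φ‖)
      (fun n ↦ (φ.continuous.measurable.comp_aemeasurable (hw n)).aestronglyMeasurable)
      (integrable_const _) (fun n ↦ Eventually.of_forall fun x ↦ φ.norm_coe_le_norm _) ?_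
    filter_upwards [hk] with x hx
    exact (φ.continuous.tendsto _).comp hx
  refine tendsto_nhds_unique (hlim hu hf) ((hlim hv hh).congr' ?_)
  filter_upwards [huv] with n hn
  rw [hn]

theorem map_eq_map_const_sub_of_reversible [IsFiniteMeasure μ] {c : ℝ} {f : X → ℝ}
    (hT : MeasurePreserving T μ μ) (hR : MeasurePreserving R μ μ) (hg : Measurable g)
    (hTR : ∀ᵐ x ∂μ, T (R (T x)) = R x) (hgR : ∀ᵐ x ∂μ, g (R (T x)) = c - g x)
    (hf : ∀ᵐ x ∂μ, Tendsto (birkhoffAverage ℝ T g · x) atTop (𝓝 (f x))) :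
    μ.map f = μ.map (fun x ↦ c - f x) := by
  have hA := measurable_birkhoffAverage hT.measurable hg
  refine map_eq_map_of_ae_tendsto (fun n ↦ (hA n).aemeasurable)
    (fun n ↦ ((hA n).const_sub c).aemeasurable) hf (hf.mono fun x hx ↦ hx.const_sub c) ?_
  filter_upwards [eventually_ne_atTop 0] with n hn
  have hRT : MeasurePreserving (R ∘ T^[n]) μ μ := hR.comp (hT.iterate n)
  have horbit : ∀ {p : X → Prop}, (∀ᵐ x ∂μ, p x) → ∀ᵐ x ∂μ, ∀ k, p (T^[k] x) := fun hp ↦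
    ae_all_iff.2 fun k ↦ (hT.iterate k).quasiMeasurePreserving.ae hp
  calc μ.map (birkhoffAverage ℝ T g n)
      = (μ.map (R ∘ T^[n])).map (birkhoffAverage ℝ T g n) := by rw [hRT.map_eq]
    _ = μ.map (birkhoffAverage ℝ T g n ∘ (R ∘ T^[n])) := Measure.map_map (hA n) hRT.measurable
    _ = μ.map fun x ↦ c - birkhoffAverage ℝ T g n x := by
        refine Measure.map_congr ?_
        filter_upwards [horbit hTR, horbit hgR] with x hTx hgx
        exact birkhoffAverage_apply_reversed hn (fun k _ ↦ hTx k) fun k _ ↦ hgx k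

theorem integral_eq_half_mul_of_map_eq_map_const_sub [IsFiniteMeasure μ] {c : ℝ} {f : X → ℝ}
    (hf : Integrable f μ) (h : μ.map f = μ.map fun x ↦ c - f x) :
    ∫ x, f x ∂μ = c / 2 * μ.real univ := by
  have heq : ∫ x, f x ∂μ = ∫ x, (c - f x) ∂μ := by
    calc ∫ x, f x ∂μ = ∫ y, y ∂μ.map f :=
        (integral_map hf.aemeasurable aestronglyMeasurable_id).symm
      _ = ∫ y, y ∂μ.map fun x ↦ c - f x := by rw [h]
      _ = ∫ x, (c - f x) ∂μ :=
        integral_map (hf.aemeasurable.const_sub c) aestronglyMeasurable_id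
  rw [integral_sub (integrable_const c) hf, integral_const, smul_eq_mul] at heq
  linarith

end Reversibility

/-! ### The area formula on the line -/

section AreaFormula

variable {f f' : ℝ → ℝ} {A : Set ℝ}

theorem exists_partition_injOn_of_hasDerivWithinAt
    (hf : ∀ x ∈ A, HasDerivWithinAt f (f' x) A x) (hf' : ∀ x ∈ A, f' x ≠ 0) :
    ∃ V : ℕ → Set ℝ, Pairwise (Function.onFun Disjoint V) ∧ (∀ n, MeasurableSet (V n)) ∧
      (A ⊆ ⋃ n, V n) ∧ ∀ n, InjOn f (A ∩ V n) := by
  classical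
  obtain ⟨V, D, hdisj, hmeas, hcover, happrox, hD⟩ :=
    exists_partition_approximatesLinearOn_of_hasFDerivWithinAt f A _
      (fun x hx ↦ (hf x hx).hasFDerivWithinAt) (fun D ↦ if D = 0 then 1 else ‖D‖₊ / 2)
      fun D ↦ by split_ifs with h <;> simp [h]
  refine ⟨V, hdisj, hmeas, hcover, fun n x hx y hy hxy ↦ ?_⟩
  obtain ⟨z, hzA, hz⟩ := hD ⟨x, hx.1⟩ n
  have hbound := happrox n x hx y hy
  have hnorm : ‖D n‖ = |f' z| := by simp [hz]
  have hne : D n ≠ 0 := by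
    rw [← norm_ne_zero_iff, hnorm]
    exact abs_ne_zero.2 (hf' z hzA)
  rw [if_neg hne, hxy, sub_self, zero_sub, norm_neg, hz] at hbound
  have hcontract : |x - y| * |f' z| ≤ |f' z| / 2 * |x - y| := by simpa using hbound
  by_contra hne
  nlinarith [mul_pos (abs_pos.2 (sub_ne_zero.2 hne)) (abs_pos.2 (hf' z hzA))]

theorem lintegral_abs_deriv_eq_volume_image (hA : MeasurableSet A)
    (hf : ∀ x ∈ A, HasDerivWithinAt f (f' x) A x) (hfi : InjOn f A) :
    ∫⁻ x in A, ENNReal.ofReal |f' x| = volume (f '' A) := by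
  simpa using (lintegral_image_eq_lintegral_abs_deriv_mul hA hf hfi fun _ ↦ 1).symm

theorem lintegral_abs_deriv_eq_zero_of_volume_image_eq_zero (hA : MeasurableSet A)
    (hf : ∀ x ∈ A, HasDerivWithinAt f (f' x) A x) (hf' : ∀ x ∈ A, f' x ≠ 0)
    (h : volume (f '' A) = 0) : ∫⁻ x in A, ENNReal.ofReal |f' x| = 0 := by
  obtain ⟨V, hdisj, hmeas, hcover, hinj⟩ := exists_partition_injOn_of_hasDerivWithinAt hf hf'
  rw [← inter_eq_left.2 hcover, inter_iUnion, lintegral_iUnion (fun n ↦ hA.inter (hmeas n))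
    (hdisj.mono fun i j hij ↦ hij.mono inter_subset_right inter_subset_right)]
  refine ENNReal.tsum_eq_zero.2 fun n ↦ ?_
  rw [lintegral_abs_deriv_eq_volume_image (hA.inter (hmeas n))
    (fun x hx ↦ (hf x hx.1).mono inter_subset_left) (hinj n)]
  exact measure_mono_null (image_mono inter_subset_left) h

theorem lintegral_abs_deriv_image_eq {e : ℝ → ℝ} (hA : MeasurableSet A) (he : Measurable e)
    (hei : InjOn e A) (hf : ∀ x ∈ A ∪ e '' A, HasDerivWithinAt f (f' x) (A ∪ e '' A) x)
    (hf' : ∀ x ∈ A, f' x ≠ 0) (hfe : ∀ x ∈ A, f (e x) = f x) :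
    ∫⁻ x in e '' A, ENNReal.ofReal |f' x| = ∫⁻ x in A, ENNReal.ofReal |f' x| := by
  have hfA : ∀ x ∈ A, HasDerivWithinAt f (f' x) A x := fun x hx ↦
    (hf x (Or.inl hx)).mono subset_union_left
  obtain ⟨V, hdisj, hmeas, hcover, hinj⟩ := exists_partition_injOn_of_hasDerivWithinAt hfA hf'
  have hAV : A = ⋃ n, A ∩ V n := by rw [← inter_iUnion, inter_eq_left.2 hcover]
  have hVm : ∀ n, MeasurableSet (A ∩ V n) := fun n ↦ hA.inter (hmeas n)
  have heVm : ∀ n, MeasurableSet (e '' (A ∩ V n)) := fun n ↦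
    (hVm n).image_of_measurable_injOn he (hei.mono inter_subset_left)
  have hVd : Pairwise (Function.onFun Disjoint fun n ↦ A ∩ V n) :=
    hdisj.mono fun i j hij ↦ hij.mono inter_subset_right inter_subset_right
  have heVd : Pairwise (Function.onFun Disjoint fun n ↦ e '' (A ∩ V n)) := fun i j hij ↦
    (hVd hij).image hei inter_subset_left inter_subset_left
  have hpiece : ∀ n, ∫⁻ x in e '' (A ∩ V n), ENNReal.ofReal |f' x| =
      ∫⁻ x in A ∩ V n, ENNReal.ofReal |f' x| := by
    intro n
    have hfe' : EqOn (f ∘ e) f (A ∩ V n) := fun x hx ↦ hfe x hx.1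
    rw [lintegral_abs_deriv_eq_volume_image (hVm n)
        (fun x hx ↦ (hfA x hx.1).mono inter_subset_left) (hinj n),
      lintegral_abs_deriv_eq_volume_image (heVm n) ?_ (hfe'.injOn_iff.2 (hinj n)).image_of_comp,
      ← image_comp, hfe'.image_eq]
    exact fun y hy ↦ (hf y (Or.inr (image_mono inter_subset_left hy))).mono
      ((image_mono inter_subset_left).trans subset_union_right)
  rw [hAV, image_iUnion, lintegral_iUnion heVm heVd, lintegral_iUnion hVm hVd]
  exact tsum_congr hpiece

end AreaFormula

/-! ### The billiard map -/

section MeasurableGraph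

variable {X Y : Type*} [MeasurableSpace X] [StandardBorelSpace X] [MeasurableSpace Y]
  [StandardBorelSpace Y] {f : X → Y} {S : Set (X × Y)}

theorem measurableSet_image_fst_of_graph (hS : MeasurableSet S) (hfS : ∀ q ∈ S, f q.1 = q.2) :
    MeasurableSet (Prod.fst '' S) :=
  hS.image_of_measurable_injOn measurable_fst fun q hq q' hq' h ↦
    Prod.ext h (by rw [← hfS q hq, ← hfS q' hq', h])

theorem measurable_of_graph {g : X → Y} (hS : MeasurableSet S) (hg : Measurable g)
    (hfS : ∀ q ∈ S, f q.1 = q.2) (hfg : ∀ x ∉ Prod.fst '' S, f x = g x) : Measurable f := by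
  intro B hB
  have hpreimage : f ⁻¹' B =
      Prod.fst '' (S ∩ Prod.snd ⁻¹' B) ∪ g ⁻¹' B \ (Prod.fst '' S) := by
    ext x
    by_cases hx : x ∈ Prod.fst '' S
    · obtain ⟨q, hq, rfl⟩ := hx
      have hmem : q.1 ∈ Prod.fst '' S := mem_image_of_mem _ hq
      simp only [mem_preimage, hfS q hq, mem_union, Set.mem_sdiff, hmem, not_true_eq_false,
        and_false, or_false]
      refine ⟨fun h ↦ ⟨q, ⟨hq, h⟩, rfl⟩, ?_⟩
      rintro ⟨q', ⟨hq', hB'⟩, h⟩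
      rwa [← hfS q hq, ← h, hfS q' hq']
    · have hx' : x ∉ Prod.fst '' (S ∩ Prod.snd ⁻¹' B) := fun h ↦ hx (image_mono inter_subset_left h)
      simp only [mem_preimage, hfg x hx, mem_union, Set.mem_sdiff, hx, hx', not_false_eq_true,
        and_true, false_or]
  rw [hpreimage]
  exact (measurableSet_image_fst_of_graph (hS.inter (measurable_snd hB)) fun q hq ↦
    hfS q hq.1).union ((hg hB).diff (measurableSet_image_fst_of_graph hS hfS))

end MeasurableGraph

section Segment

variable {E : Type*} [NormedAddCommGroup E] [NormedSpace ℝ E] {U : Set E}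

theorem openSegment_self_add_smul (x v : E) {t : ℝ} (ht : 0 < t) :
    openSegment ℝ x (x + t • v) = (fun u : ℝ ↦ x + u • v) '' Ioo 0 t := by
  have hIoo : Ioo 0 t = (· * t) '' Ioo (0 : ℝ) 1 := by
    rw [image_mul_right_Ioo _ _ ht, zero_mul, one_mul]
  rw [openSegment_eq_image', hIoo, image_image]
  simp only [add_sub_cancel_left, mul_smul]

theorem measurableSet_openSegment_subset [MeasurableSpace E] [BorelSpace E]
    [SecondCountableTopology E] (hU : IsOpen U) :
    MeasurableSet {q : E × E | openSegment ℝ q.1 q.2 ⊆ U} := by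
  have hexhaust : {q : E × E | openSegment ℝ q.1 q.2 ⊆ U} =
      ⋂ n : ℕ, {q : E × E | ∀ u ∈ Icc (1 / (n + 1) : ℝ) (1 - 1 / (n + 1)),
        q.1 + u • (q.2 - q.1) ∈ U} := by
    ext q
    rw [mem_ofPred_eq, openSegment_eq_image', image_subset_iff, mem_iInter]
    constructor
    · intro hq n u hu
      have : (0 : ℝ) < 1 / (n + 1) := Nat.one_div_pos_of_nat
      exact hq ⟨by linarith [hu.1], by linarith [hu.2]⟩
    · intro hq u hu
      obtain ⟨n, hn⟩ := exists_nat_one_div_lt (lt_min hu.1 (sub_pos.2 hu.2))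
      obtain ⟨hn0, hn1⟩ := lt_min_iff.1 hn
      exact hq n u ⟨hn0.le, by linarith⟩
  rw [hexhaust]
  refine MeasurableSet.iInter fun n ↦ (isOpen_iff_mem_nhds.2 fun q hq ↦ ?_).measurableSet
  refine isCompact_Icc.eventually_forall_of_forall_eventually fun u hu ↦ ?_
  have hc : Continuous fun y : (E × E) × ℝ ↦ y.1.1 + y.2 • (y.1.2 - y.1.1) := by fun_prop
  exact hc.continuousAt.eventually (hU.mem_nhds (hq u hu))

end Segment

variable {Ω : Set ℂ} {L : ℝ} {γ : ℝ → ℂ} {z w w' : ℝ × ℝ}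

section Reversal

/-- Time reversal of phase points: the reversed ball leaves the same footpoint in the direction
opposite to the one from which the original ball arrived there. -/
noncomputable def reversal (z : ℝ × ℝ) : ℝ × ℝ := (z.1, Real.pi - z.2)

@[simp]
theorem reversal_fst (z : ℝ × ℝ) : (reversal z).1 = z.1 := rfl

@[simp]
theorem reversal_snd (z : ℝ × ℝ) : (reversal z).2 = Real.pi - z.2 := rfl

theorem reversal_involutive : Function.Involutive reversal := fun z ↦ by ext <;> simp

theorem measurable_reversal : Measurable reversal := by
  unfold reversal
  fun_prop

theorem reversal_mem_smoothPhase (hz : z ∈ smoothPhase L γ) : reversal z ∈ smoothPhase L γ :=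
  ⟨hz.1, hz.2.1, by simpa using hz.2.2.2, by simpa using hz.2.2.1⟩

theorem outVelocity_reversal (γ : ℝ → ℂ) (z : ℝ × ℝ) :
    outVelocity γ (reversal z) = -inVelocity γ z := by
  have hangle : ((Real.pi - z.2 : ℝ) : ℂ) * Complex.I =
      Real.pi * Complex.I + -(z.2 * Complex.I) := by push_cast; ring
  rw [outVelocity, inVelocity, reversal_fst, reversal_snd, hangle, Complex.exp_add,
    Complex.exp_pi_mul_I]
  ring

theorem inVelocity_reversal (γ : ℝ → ℂ) (z : ℝ × ℝ) :
    inVelocity γ (reversal z) = -outVelocity γ z := by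
  rw [← neg_eq_iff_eq_neg, ← outVelocity_reversal, reversal_involutive]

theorem Step.reverse (h : Step Ω L γ z w) : Step Ω L γ (reversal w) (reversal z) := by
  obtain ⟨hz, hw, ⟨t, ht, hγ, hΩ⟩, hv⟩ := h
  have hback : outVelocity γ (reversal w) = -outVelocity γ z := by rw [outVelocity_reversal, hv]
  refine ⟨reversal_mem_smoothPhase hw, reversal_mem_smoothPhase hz, ⟨t, ht, ?_, fun u hu ↦ ?_⟩, ?_⟩
  · rw [hback, reversal_fst, reversal_fst, hγ]
    ring
  · have hmem := hΩ (t - u) ⟨sub_pos.2 hu.2, sub_lt_self t hu.1⟩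
    rw [hback, reversal_fst, hγ]
    convert hmem using 1
    push_cast
    ring
  · rw [hback, inVelocity_reversal]

end Reversal

section BilliardMap

theorem step_billiardMap (hz : z ∈ mapDomain Ω L γ) : Step Ω L γ z (billiardMap Ω L γ z) := by
  have hex : ∃ w, Step Ω L γ z w := hz
  rw [billiardMap, dif_pos hex]
  exact hex.choose_spec

theorem billiardMap_of_notMem (hz : z ∉ mapDomain Ω L γ) : billiardMap Ω L γ z = z :=
  dif_neg hz

namespace IsBoundaryParam

theorem mem_frontier (hγ : IsBoundaryParam Ω L γ) (s : ℝ) : γ s ∈ frontier Ω :=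
  hγ.range_eq ▸ mem_range_self s

theorem notMem (hγ : IsBoundaryParam Ω L γ) (hopen : IsOpen Ω) (s : ℝ) : γ s ∉ Ω :=
  fun h ↦ hopen.inter_frontier_eq.subset ⟨h, hγ.mem_frontier s⟩

theorem norm_outVelocity (hγ : IsBoundaryParam Ω L γ) (hz : ContDiffAt ℝ 1 γ z.1) :
    ‖outVelocity γ z‖ = 1 := by
  rw [outVelocity, norm_mul, hγ.unit_speed _ hz, Complex.norm_exp_ofReal_mul_I, mul_one]

theorem deriv_ne_zero (hγ : IsBoundaryParam Ω L γ) {s : ℝ} (hs : ContDiffAt ℝ 1 γ s) :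
    deriv γ s ≠ 0 :=
  norm_ne_zero_iff.1 (by simp [hγ.unit_speed s hs])

theorem snd_eq_of_inVelocity_eq (hγ : IsBoundaryParam Ω L γ) (hw : w ∈ smoothPhase L γ)
    (hw' : w' ∈ smoothPhase L γ) (h1 : w.1 = w'.1) (h : inVelocity γ w = inVelocity γ w') :
    w.2 = w'.2 := by
  rw [inVelocity, inVelocity, ← h1] at h
  have hexp := mul_left_cancel₀ (hγ.deriv_ne_zero hw.2.1) h
  rw [Complex.exp_neg, Complex.exp_neg, inv_inj] at hexp
  have hcos := congrArg Complex.re hexp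
  rw [Complex.exp_ofReal_mul_I_re, Complex.exp_ofReal_mul_I_re] at hcos
  exact Real.injOn_cos (Ioo_subset_Icc_self hw.2.2) (Ioo_subset_Icc_self hw'.2.2) hcos

theorem step_unique (hγ : IsBoundaryParam Ω L γ) (hopen : IsOpen Ω) (h : Step Ω L γ z w)
    (h' : Step Ω L γ z w') : w = w' := by
  obtain ⟨-, hw, ⟨t, ht, hγt, hΩ⟩, hv⟩ := h
  obtain ⟨-, hw', ⟨t', ht', hγt', hΩ'⟩, hv'⟩ := h'
  have htime : t = t' := by
    rcases lt_trichotomy t t' with hlt | heq | hlt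
    · exact absurd (hγt ▸ hΩ' t ⟨ht, hlt⟩) (hγ.notMem hopen _)
    · exact heq
    · exact absurd (hγt' ▸ hΩ t' ⟨ht', hlt⟩) (hγ.notMem hopen _)
  have hfoot : w.1 = w'.1 := hγ.injOn hw.1 hw'.1 (by rw [hγt, hγt', htime])
  exact Prod.ext hfoot (hγ.snd_eq_of_inVelocity_eq hw hw' hfoot (hv.symm.trans hv'))

theorem billiardMap_eq (hγ : IsBoundaryParam Ω L γ) (hopen : IsOpen Ω) (h : Step Ω L γ z w) :
    billiardMap Ω L γ z = w :=
  hγ.step_unique hopen (step_billiardMap ⟨w, h⟩) h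

theorem step_iff (hγ : IsBoundaryParam Ω L γ) : Step Ω L γ z w ↔
    z ∈ smoothPhase L γ ∧ w ∈ smoothPhase L γ ∧ γ z.1 ≠ γ w.1 ∧
      γ w.1 = γ z.1 + ‖γ w.1 - γ z.1‖ • outVelocity γ z ∧
      openSegment ℝ (γ z.1) (γ w.1) ⊆ Ω ∧ outVelocity γ z = inVelocity γ w := by
  constructor
  · rintro ⟨hz, hw, ⟨t, ht, hγt, hΩ⟩, hv⟩
    simp only [← Complex.real_smul] at hγt hΩ
    have hdist : ‖γ w.1 - γ z.1‖ = t := by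
      rw [hγt, add_sub_cancel_left, norm_smul, hγ.norm_outVelocity hz.2.1, mul_one,
        Real.norm_of_nonneg ht.le]
    refine ⟨hz, hw, fun h ↦ ?_, by rwa [hdist], ?_, hv⟩
    · rw [h, sub_self, norm_zero] at hdist
      exact ht.ne hdist
    · rw [hγt, openSegment_self_add_smul _ _ ht]
      exact image_subset_iff.2 hΩ
  · rintro ⟨hz, hw, hne, hγt, hΩ, hv⟩
    have hdist : 0 < ‖γ w.1 - γ z.1‖ := norm_sub_pos_iff.2 hne.symm
    rw [hγt, openSegment_self_add_smul _ _ hdist, image_subset_iff] at hΩ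
    exact ⟨hz, hw, ⟨_, hdist, hγt, hΩ⟩, hv⟩

end IsBoundaryParam

theorem isOpen_setOf_contDiffAt (γ : ℝ → ℂ) : IsOpen {s | ContDiffAt ℝ 1 γ s} :=
  isOpen_iff_mem_nhds.2 fun _ hs ↦ ContDiffAt.eventually hs (by simp)

theorem measurableSet_smoothPhase (L : ℝ) (γ : ℝ → ℂ) : MeasurableSet (smoothPhase L γ) :=
  (measurable_fst measurableSet_Ico).inter
    ((measurable_fst (isOpen_setOf_contDiffAt γ).measurableSet).inter
      (measurable_snd measurableSet_Ioo))

theorem measurable_outVelocity (γ : ℝ → ℂ) : Measurable (outVelocity γ) :=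
  ((measurable_deriv γ).comp measurable_fst).mul (by fun_prop)

theorem measurable_inVelocity (γ : ℝ → ℂ) : Measurable (inVelocity γ) :=
  ((measurable_deriv γ).comp measurable_fst).mul (by fun_prop)

namespace IsBoundaryParam

theorem measurableSet_step (hγ : IsBoundaryParam Ω L γ) (hopen : IsOpen Ω) :
    MeasurableSet {q : (ℝ × ℝ) × (ℝ × ℝ) | Step Ω L γ q.1 q.2} := by
  have hm := hγ.continuous.measurable
  have hfrom : Measurable fun q : (ℝ × ℝ) × (ℝ × ℝ) ↦ γ q.1.1 := by fun_prop
  have hto : Measurable fun q : (ℝ × ℝ) × (ℝ × ℝ) ↦ γ q.2.1 := by fun_prop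
  have hout : Measurable fun q : (ℝ × ℝ) × (ℝ × ℝ) ↦ outVelocity γ q.1 :=
    (measurable_outVelocity γ).comp measurable_fst
  have hin : Measurable fun q : (ℝ × ℝ) × (ℝ × ℝ) ↦ inVelocity γ q.2 :=
    (measurable_inVelocity γ).comp measurable_snd
  simp only [hγ.step_iff]
  exact (measurable_fst (measurableSet_smoothPhase L γ)).inter
    ((measurable_snd (measurableSet_smoothPhase L γ)).inter
    ((measurableSet_eq_fun hfrom hto).compl.inter
    ((measurableSet_eq_fun hto (hfrom.add ((hto.sub hfrom).norm.smul hout))).inter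
    ((hfrom.prodMk hto (measurableSet_openSegment_subset hopen)).inter
    (measurableSet_eq_fun hout hin)))))

theorem billiardMap_eq_of_mem_step (hγ : IsBoundaryParam Ω L γ) (hopen : IsOpen Ω) :
    ∀ q ∈ {q : (ℝ × ℝ) × (ℝ × ℝ) | Step Ω L γ q.1 q.2}, billiardMap Ω L γ q.1 = q.2 :=
  fun _ hq ↦ hγ.billiardMap_eq hopen hq

end IsBoundaryParam

theorem mapDomain_eq_image_step (Ω : Set ℂ) (L : ℝ) (γ : ℝ → ℂ) :
    mapDomain Ω L γ = Prod.fst '' {q : (ℝ × ℝ) × (ℝ × ℝ) | Step Ω L γ q.1 q.2} := by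
  ext z
  exact ⟨fun ⟨w, h⟩ ↦ ⟨(z, w), h, rfl⟩, fun ⟨q, h, hq⟩ ↦ ⟨q.2, hq ▸ h⟩⟩

namespace IsBoundaryParam

theorem measurableSet_mapDomain (hγ : IsBoundaryParam Ω L γ) (hopen : IsOpen Ω) :
    MeasurableSet (mapDomain Ω L γ) := by
  rw [mapDomain_eq_image_step]
  exact measurableSet_image_fst_of_graph (hγ.measurableSet_step hopen)
    (hγ.billiardMap_eq_of_mem_step hopen)

theorem measurable_billiardMap (hγ : IsBoundaryParam Ω L γ) (hopen : IsOpen Ω) :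
    Measurable (billiardMap Ω L γ) :=
  measurable_of_graph (hγ.measurableSet_step hopen) measurable_id
    (hγ.billiardMap_eq_of_mem_step hopen) fun _ hz ↦
      billiardMap_of_notMem (by rwa [mapDomain_eq_image_step])

end IsBoundaryParam

end BilliardMap

/-! ### First collisions -/

section Tangency

theorem map_nhds_eq_nhdsWithin_range_of_periodic {X : Type*} [TopologicalSpace X] [T2Space X]
    {p : ℝ} {f : ℝ → X} (hp : 0 < p) (hf : Continuous f) (hper : Function.Periodic f p)
    (hinj : InjOn f (Ico 0 p)) (a : ℝ) : map f (𝓝 a) = 𝓝[range f] (f a) := by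
  have : Fact (0 < p) := ⟨hp⟩
  have hrange : range hper.lift = range f :=
    (QuotientAddGroup.mk_surjective.range_comp hper.lift).symm
  have hlift : Function.Injective hper.lift := by
    intro y z hyz
    obtain ⟨s, hs, rfl⟩ := (AddCircle.coe_image_Ico_eq p 0).symm.subset (mem_univ y)
    obtain ⟨t, ht, rfl⟩ := (AddCircle.coe_image_Ico_eq p 0).symm.subset (mem_univ z)
    rw [zero_add] at hs ht
    rw [hinj hs ht hyz]
  have hcont : Continuous hper.lift := continuous_coinduced_dom.2 hf
  have hemb := (hcont.isClosedEmbedding hlift).isEmbedding.map_nhds_eq (a : AddCircle p)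
  have hcoe : map ((↑) : ℝ → AddCircle p) (𝓝 a) = 𝓝 (a : AddCircle p) :=
    QuotientAddGroup.isOpenMap_coe.map_nhds_eq continuous_quotient_mk'.continuousAt
  rwa [← hcoe, map_map, hrange] at hemb

variable {E : Type*} [NormedAddCommGroup E] [NormedSpace ℝ E] {S U K : Set E} {x v w : E}
  {A : E →L[ℝ] ℝ}

theorem isLittleO_apply_sub_of_map_nhds_eq {f : ℝ → E} {a : ℝ} (hf : HasDerivAt f v a)
    (hv : v ≠ 0) (hA : A v = 0) (hS : map f (𝓝 a) = 𝓝[S] (f a)) :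
    (fun y ↦ A (y - f a)) =o[𝓝[S] (f a)] fun y ↦ y - f a := by
  rw [← hS, Asymptotics.isLittleO_map]
  have hAf : (fun s ↦ A (f s - f a)) = fun s ↦ A (f s - f a - (s - a) • v) := by
    ext s
    rw [map_sub A _ (_ • v), map_smul, hA, smul_zero, sub_zero]
  have hrev : (fun s ↦ s - a) =O[𝓝 a] fun s ↦ f s - f a :=
    (hf.hasFDerivAt.isTheta_sub (isClosedEmbedding_smul_left hv).isInducing).isBigO_symm
  change (fun s ↦ A (f s - f a)) =o[𝓝 a] fun s ↦ f s - f a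
  rw [hAf]
  exact ((A.isBigO_comp _ _).trans_isLittleO (hasDerivAt_iff_isLittleO.1 hf)).trans_isBigO hrev

theorem eventually_forall_add_smul_notMem_of_isLittleO
    (hS : (fun y ↦ A (y - x)) =o[𝓝[S] x] fun y ↦ y - x) (hK : IsCompact K)
    (hAK : ∀ d ∈ K, A d ≠ 0) : ∀ᶠ u : ℝ in 𝓝[>] 0, ∀ d ∈ K, x + u • d ∉ S := by
  suffices h : ∀ d ∈ K, ∀ᶠ q : ℝ × E in 𝓝 (0, d), 0 < q.1 → x + q.1 • q.2 ∉ S by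
    filter_upwards [eventually_nhdsWithin_of_eventually_nhds
      (hK.eventually_forall_of_forall_eventually
        (P := fun u d ↦ 0 < u → x + u • d ∉ S) h), self_mem_nhdsWithin] with u hu hpos d hd
    exact hu d hd hpos
  intro d hd
  obtain ⟨c, hc, hcd⟩ : ∃ c > 0, c * ‖d‖ < |A d| := by
    refine ⟨|A d| / (‖d‖ + 1), by have := hAK d hd; positivity, ?_⟩
    rw [div_mul_eq_mul_div, div_lt_iff₀ (by positivity)]
    nlinarith [abs_pos.2 (hAK d hd)]
  have hnear : ∀ᶠ q : ℝ × E in 𝓝 (0, d), c * ‖q.2‖ < |A q.2| := by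
    have hopen : IsOpen {q : ℝ × E | c * ‖q.2‖ < |A q.2|} :=
      isOpen_lt (by fun_prop) (by fun_prop)
    exact hopen.mem_nhds hcd
  have htendsto : Tendsto (fun q : ℝ × E ↦ x + q.1 • q.2) (𝓝 (0, d)) (𝓝 x) := by
    have hcont : Continuous fun q : ℝ × E ↦ x + q.1 • q.2 := by fun_prop
    simpa using hcont.tendsto (0, d)
  filter_upwards [hnear, htendsto.eventually (eventually_nhdsWithin_iff.1 (hS.def hc))]
    with q hq hle hpos hmem
  have hle' := hle hmem
  rw [add_sub_cancel_left, map_smul, norm_smul, norm_smul, mul_left_comm, Real.norm_eq_abs (A _)]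
    at hle'
  exact hq.not_ge (le_of_mul_le_mul_left hle' (norm_pos_iff.2 hpos.ne'))

theorem subset_of_isPreconnected_of_disjoint_frontier {X : Type*} [TopologicalSpace X]
    {S U : Set X} (hS : IsPreconnected S) (hU : IsOpen U) (hd : Disjoint S (frontier U))
    (hne : (S ∩ U).Nonempty) : S ⊆ U := by
  have : PreconnectedSpace S := Subtype.preconnectedSpace hS
  obtain ⟨x, hxS, hxU⟩ := hne
  have hclopen := (isClopen_preimage_val hU hd.symm).eq_univ ⟨⟨x, hxS⟩, hxU⟩
  simpa using preimage_eq_univ_iff.1 hclopen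

theorem eventually_mem_iff_mem_of_isLittleO_frontier (hopen : IsOpen U)
    (hU : (fun y ↦ A (y - x)) =o[𝓝[frontier U] x] fun y ↦ y - x) (hv : 0 < A v) (hw : 0 < A w) :
    ∀ᶠ u : ℝ in 𝓝[>] 0, (x + u • v ∈ U ↔ x + u • w ∈ U) := by
  have hK : IsCompact (segment ℝ v w) := by
    rw [segment_eq_image_lineMap]
    exact isCompact_Icc.image AffineMap.lineMap_continuous
  have hpos : segment ℝ v w ⊆ {d | 0 < A d} :=
    (convex_halfSpace_gt A.isLinear 0).segment_subset hv hw
  filter_upwards [eventually_forall_add_smul_notMem_of_isLittleO hU hK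
    fun d hd ↦ (hpos hd).ne'] with u hu
  have hconn : IsPreconnected ((fun d ↦ x + u • d) '' segment ℝ v w) :=
    (convex_segment v w).isPreconnected.image _ (by fun_prop)
  have hdisj : Disjoint ((fun d ↦ x + u • d) '' segment ℝ v w) (frontier U) :=
    disjoint_left.2 (forall_mem_image.2 hu)
  have hvS := mem_image_of_mem (fun d ↦ x + u • d) (left_mem_segment ℝ v w)
  have hwS := mem_image_of_mem (fun d ↦ x + u • d) (right_mem_segment ℝ v w)
  exact ⟨fun h ↦ subset_of_isPreconnected_of_disjoint_frontier hconn hopen hdisj ⟨_, hvS, h⟩ hwS,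
    fun h ↦ subset_of_isPreconnected_of_disjoint_frontier hconn hopen hdisj ⟨_, hwS, h⟩ hvS⟩

theorem exists_first_exit (hU : IsOpen U) (hb : Bornology.IsBounded U) (hv : v ≠ 0)
    (h : ∀ᶠ u : ℝ in 𝓝[>] 0, x + u • v ∈ U) :
    ∃ t : ℝ, 0 < t ∧ x + t • v ∈ frontier U ∧ ∀ u ∈ Ioo 0 t, x + u • v ∈ U := by
  have hc : Continuous fun u : ℝ ↦ x + u • v := by fun_prop
  obtain ⟨r, hr, hrU⟩ := mem_nhdsGT_iff_exists_Ioo_subset.1 h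
  have hclosed : IsClosed (Ici r ∩ {u | x + u • v ∉ U}) :=
    isClosed_Ici.inter (hU.isClosed_compl.preimage hc)
  have hbelow : BddBelow (Ici r ∩ {u | x + u • v ∉ U}) := bddBelow_Ici.mono inter_subset_left
  have hnonempty : (Ici r ∩ {u | x + u • v ∉ U}).Nonempty := by
    obtain ⟨R, hR⟩ := hb.exists_norm_le
    have hlarge : Tendsto (fun u : ℝ ↦ ‖u • v‖ - ‖x‖) atTop atTop := by
      refine tendsto_atTop_add_const_right _ _ ?_
      simp only [norm_smul]
      exact tendsto_norm_atTop_atTop.atTop_mul_const (norm_pos_iff.2 hv)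
    obtain ⟨u, hur, hu⟩ := ((eventually_ge_atTop r).and (hlarge.eventually_gt_atTop R)).exists
    refine ⟨u, hur, fun hmem ↦ hu.not_ge ((sub_le_iff_le_add.2 ?_).trans (hR _ hmem))⟩
    simpa using norm_sub_le (x + u • v) x
  obtain ⟨hrt, htU⟩ := hclosed.csInf_mem hnonempty hbelow
  set t := sInf (Ici r ∩ {u | x + u • v ∉ U})
  have ht : 0 < t := (mem_Ioi.1 hr).trans_le hrt
  have hbefore : ∀ u ∈ Ioo 0 t, x + u • v ∈ U := by
    intro u hu
    rcases lt_or_ge u r with hur | hru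
    · exact hrU ⟨hu.1, hur⟩
    · by_contra hmem
      exact (csInf_le hbelow ⟨hru, hmem⟩).not_gt hu.2
  refine ⟨t, ht, ?_, hbefore⟩
  rw [hU.frontier_eq]
  refine ⟨mem_closure_of_tendsto (hc.continuousWithinAt (s := Iio t)) ?_, htU⟩
  filter_upwards [Ioo_mem_nhdsLT ht] with u hu using hbefore u hu

end Tangency

/-! ### Flux of a parallel stream -/

section BoundaryGeometry

attribute [local instance] Complex.finrank_real_complex_fact

local notation "ω" => Orientation.areaForm' Complex.orientation

variable {s : ℝ} {v : ℂ}

/-- The component of a velocity along the inner unit normal at the boundary point `s`, as a linear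
functional of the velocity. -/
noncomputable def normalComponent (γ : ℝ → ℂ) (s : ℝ) : ℂ →L[ℝ] ℝ :=
  ω (deriv γ s)

/-- The phase point with footpoint `s` and outgoing velocity `v`; meaningful for unit vectors `v`
with a positive normal component at `s`. -/
noncomputable def phasePoint (γ : ℝ → ℂ) (v : ℂ) (s : ℝ) : ℝ × ℝ :=
  (s, Complex.arg (conj (deriv γ s) * v))

theorem areaForm'_apply_eq_im (w v : ℂ) : ω w v = (conj w * v).im := by
  simp

theorem normalComponent_apply (γ : ℝ → ℂ) (s : ℝ) (v : ℂ) :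
    normalComponent γ s v = (conj (deriv γ s) * v).im :=
  areaForm'_apply_eq_im _ _

theorem areaForm'_deriv (γ : ℝ → ℂ) (v : ℂ) (s : ℝ) :
    ω v (deriv γ s) = -normalComponent γ s v :=
  Complex.orientation.areaForm_swap v (deriv γ s)

theorem phasePoint_mem_smoothPhase (hs : s ∈ Ico 0 L) (hs' : ContDiffAt ℝ 1 γ s)
    (hn : 0 < normalComponent γ s v) : phasePoint γ v s ∈ smoothPhase L γ := by
  rw [normalComponent_apply] at hn
  exact ⟨hs, hs', (Complex.arg_nonneg_iff.2 hn.le).lt_of_ne' fun h ↦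
    hn.ne' (Complex.arg_eq_zero_iff.1 h).2, Complex.arg_lt_pi_iff.2 (Or.inr hn.ne')⟩

namespace IsBoundaryParam

theorem conj_deriv_mul_deriv (hγ : IsBoundaryParam Ω L γ) (hs : ContDiffAt ℝ 1 γ s) :
    conj (deriv γ s) * deriv γ s = 1 := by
  rw [Complex.conj_mul', hγ.unit_speed s hs, Complex.ofReal_one, one_pow]

theorem outVelocity_phasePoint (hγ : IsBoundaryParam Ω L γ) (hv : ‖v‖ = 1)
    (hs : ContDiffAt ℝ 1 γ s) : outVelocity γ (phasePoint γ v s) = v := by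
  have hpolar := Complex.norm_mul_exp_arg_mul_I (conj (deriv γ s) * v)
  rw [norm_mul, RCLike.norm_conj, hv, hγ.unit_speed s hs, mul_one, Complex.ofReal_one,
    one_mul] at hpolar
  rw [outVelocity, phasePoint, hpolar, ← mul_assoc, mul_comm (deriv γ s),
    hγ.conj_deriv_mul_deriv hs, one_mul]

theorem conj_deriv_mul_outVelocity (hγ : IsBoundaryParam Ω L γ) (hz : ContDiffAt ℝ 1 γ z.1) :
    conj (deriv γ z.1) * outVelocity γ z = Complex.exp (z.2 * Complex.I) := by
  rw [outVelocity, ← mul_assoc, hγ.conj_deriv_mul_deriv hz, one_mul]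

theorem normalComponent_outVelocity (hγ : IsBoundaryParam Ω L γ) (hz : ContDiffAt ℝ 1 γ z.1) :
    normalComponent γ z.1 (outVelocity γ z) = Real.sin z.2 := by
  rw [normalComponent_apply, hγ.conj_deriv_mul_outVelocity hz, Complex.exp_ofReal_mul_I_im]

theorem phasePoint_outVelocity (hγ : IsBoundaryParam Ω L γ) (hz : z ∈ smoothPhase L γ) :
    phasePoint γ (outVelocity γ z) z.1 = z := by
  refine Prod.ext rfl ?_
  rw [phasePoint, hγ.conj_deriv_mul_outVelocity hz.2.1, Complex.arg_exp_mul_I,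
    toIocMod_eq_self]
  exact ⟨by linarith [hz.2.2.1, Real.pi_pos], by linarith [hz.2.2.2, Real.pi_pos]⟩

theorem exists_mem_Ico (hγ : IsBoundaryParam Ω L γ) {x : ℂ} (hx : x ∈ frontier Ω) :
    ∃ s ∈ Ico 0 L, γ s = x := by
  obtain ⟨s, rfl⟩ := hγ.range_eq.symm.subset hx
  obtain ⟨s', hs', h⟩ := hγ.periodic.exists_mem_Ico₀ hγ.perimeter_pos s
  exact ⟨s', hs', h.symm⟩

theorem isLittleO_normalComponent (hγ : IsBoundaryParam Ω L γ) (hs : ContDiffAt ℝ 1 γ s) :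
    (fun y ↦ normalComponent γ s (y - γ s)) =o[𝓝[frontier Ω] (γ s)] fun y ↦ y - γ s := by
  refine isLittleO_apply_sub_of_map_nhds_eq (hs.differentiableAt one_ne_zero).hasDerivAt
    (hγ.deriv_ne_zero hs) (Complex.orientation.areaForm_apply_self _) ?_
  rw [← hγ.range_eq]
  exact map_nhds_eq_nhdsWithin_range_of_periodic hγ.perimeter_pos hγ.continuous hγ.periodic
    hγ.injOn s

theorem normalComponent_I_mul_deriv (hγ : IsBoundaryParam Ω L γ) (hs : ContDiffAt ℝ 1 γ s) :
    normalComponent γ s (Complex.I * deriv γ s) = 1 := by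
  rw [normalComponent_apply, mul_left_comm, hγ.conj_deriv_mul_deriv hs, mul_one, Complex.I_im]

theorem eventually_mem (hγ : IsBoundaryParam Ω L γ) (hopen : IsOpen Ω)
    (hs : ContDiffAt ℝ 1 γ s) (hv : 0 < normalComponent γ s v) :
    ∀ᶠ u : ℝ in 𝓝[>] 0, γ s + u • v ∈ Ω := by
  filter_upwards [hγ.positively_oriented s hs, eventually_mem_iff_mem_of_isLittleO_frontier hopen
    (hγ.isLittleO_normalComponent hs) hv (hγ.normalComponent_I_mul_deriv hs ▸ one_pos)]
    with u hu hiff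
  exact hiff.2 hu.1

theorem eventually_notMem (hγ : IsBoundaryParam Ω L γ) (hopen : IsOpen Ω)
    (hs : ContDiffAt ℝ 1 γ s) (hv : normalComponent γ s v < 0) :
    ∀ᶠ u : ℝ in 𝓝[>] 0, γ s + u • v ∉ Ω := by
  have hinner : (-normalComponent γ s) (-(Complex.I * deriv γ s)) = 1 := by
    rw [neg_apply, map_neg, neg_neg, hγ.normalComponent_I_mul_deriv hs]
  filter_upwards [hγ.positively_oriented s hs, eventually_mem_iff_mem_of_isLittleO_frontier
    (A := -normalComponent γ s) hopen (hγ.isLittleO_normalComponent hs).neg_left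
    (neg_pos.2 hv) (hinner ▸ one_pos)] with u hu hiff hmem
  exact hu.2 (by simpa [sub_eq_add_neg] using hiff.1 hmem)

theorem normalComponent_nonpos_of_arrival (hγ : IsBoundaryParam Ω L γ) (hopen : IsOpen Ω)
    (hs : ContDiffAt ℝ 1 γ s) (harrival : ∀ᶠ u : ℝ in 𝓝[>] 0, γ s - u • v ∈ Ω) :
    normalComponent γ s v ≤ 0 := by
  by_contra! hpos
  obtain ⟨u, hu, hmem⟩ := ((hγ.eventually_notMem hopen hs (v := -v)
    (by rwa [map_neg, neg_lt_zero])).and harrival).exists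
  exact hu (by rwa [smul_neg, ← sub_eq_add_neg])

theorem exists_first_collision (hγ : IsBoundaryParam Ω L γ) (hopen : IsOpen Ω)
    (hbdd : Bornology.IsBounded Ω) (hs : ContDiffAt ℝ 1 γ s) (hn : 0 < normalComponent γ s v) :
    ∃ t : ℝ, 0 < t ∧ (∃ s' ∈ Ico 0 L, γ s' = γ s + t • v) ∧
      ∀ u ∈ Ioo 0 t, γ s + u • v ∈ Ω := by
  have hv : v ≠ 0 := by
    rintro rfl
    exact hn.ne' (map_zero _)
  obtain ⟨t, ht, hfrontier, hinside⟩ :=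
    exists_first_exit hopen hbdd hv (hγ.eventually_mem hopen hs hn)
  exact ⟨t, ht, hγ.exists_mem_Ico hfrontier, hinside⟩

theorem step_phasePoint (hγ : IsBoundaryParam Ω L γ) {s' t : ℝ} (hv : ‖v‖ = 1)
    (hs : s ∈ Ico 0 L) (hsm : ContDiffAt ℝ 1 γ s) (hn : 0 < normalComponent γ s v)
    (hs' : s' ∈ Ico 0 L) (hsm' : ContDiffAt ℝ 1 γ s') (hn' : normalComponent γ s' v < 0)
    (ht : 0 < t) (hst : γ s' = γ s + t • v) (hinside : ∀ u ∈ Ioo 0 t, γ s + u • v ∈ Ω) :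
    Step Ω L γ (phasePoint γ v s) (reversal (phasePoint γ (-v) s')) := by
  have hout := hγ.outVelocity_phasePoint hv hsm
  have hback := hγ.outVelocity_phasePoint (v := -v) (by rwa [norm_neg]) hsm'
  refine ⟨phasePoint_mem_smoothPhase hs hsm hn, reversal_mem_smoothPhase
    (phasePoint_mem_smoothPhase hs' hsm' (by rwa [map_neg, neg_pos])), ⟨t, ht, ?_, ?_⟩, ?_⟩
  · rw [hout]
    exact hst
  · rwa [hout]
  · rw [hout, inVelocity_reversal, hback, neg_neg]

theorem phasePoint_mem_mapDomain (hγ : IsBoundaryParam Ω L γ) (hopen : IsOpen Ω)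
    (hbdd : Bornology.IsBounded Ω) (hv : ‖v‖ = 1) (hs : s ∈ Ico 0 L)
    (hsm : ContDiffAt ℝ 1 γ s) (hn : 0 < normalComponent γ s v)
    (hreg : ∀ s' ∈ Ico 0 L,
      ω v (γ s') = ω v (γ s) →
        ContDiffAt ℝ 1 γ s' ∧ normalComponent γ s' v ≠ 0) :
    phasePoint γ v s ∈ mapDomain Ω L γ := by
  obtain ⟨t, ht, ⟨s', hs', hst⟩, hinside⟩ := hγ.exists_first_collision hopen hbdd hsm hn
  have hline : ω v (γ s') = ω v (γ s) := by
    have hself : ω v v = 0 := Complex.orientation.areaForm_apply_self v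
    rw [hst, map_add, map_smul, hself, smul_zero, add_zero]
  obtain ⟨hsm', htransverse⟩ := hreg s' hs' hline
  have harrival : ∀ᶠ u : ℝ in 𝓝[>] 0, γ s' - u • v ∈ Ω := by
    filter_upwards [Ioo_mem_nhdsGT ht] with u hu
    rw [hst, add_sub_assoc, ← sub_smul]
    exact hinside (t - u) ⟨sub_pos.2 hu.2, sub_lt_self t hu.1⟩
  have hn' := (hγ.normalComponent_nonpos_of_arrival hopen hsm' harrival).lt_of_ne htransverse
  exact ⟨_, hγ.step_phasePoint hv hs hsm hn hs' hsm' hn' ht hst hinside⟩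

end IsBoundaryParam

/-- The flux of a parallel stream of velocity `v` through the part `A` of the boundary, without
regard to the side from which it crosses. -/
noncomputable def flux (γ : ℝ → ℂ) (v : ℂ) (A : Set ℝ) : ENNReal :=
  ∫⁻ s in A, ENNReal.ofReal |normalComponent γ s v|

theorem flux_neg (γ : ℝ → ℂ) (v : ℂ) (A : Set ℝ) : flux γ (-v) A = flux γ v A := by
  simp only [flux, map_neg, abs_neg]

theorem hasDerivAt_areaForm'_comp (v : ℂ) (hs : ContDiffAt ℝ 1 γ s) :
    HasDerivAt (fun s ↦ ω v (γ s)) (-normalComponent γ s v) s := by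
  rw [← areaForm'_deriv]
  exact (ω v).hasFDerivAt.comp_hasDerivAt s (hs.differentiableAt one_ne_zero).hasDerivAt

theorem flux_eq_zero_of_volume_image_eq_zero {A : Set ℝ} (hA : MeasurableSet A)
    (hsm : ∀ s ∈ A, ContDiffAt ℝ 1 γ s) (hn : ∀ s ∈ A, normalComponent γ s v ≠ 0)
    (h : volume ((fun s ↦ ω v (γ s)) '' A) = 0) : flux γ v A = 0 := by
  simpa only [flux, abs_neg] using lintegral_abs_deriv_eq_zero_of_volume_image_eq_zero hA
    (fun s hs ↦ (hasDerivAt_areaForm'_comp v (hsm s hs)).hasDerivWithinAt)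
    (fun s hs ↦ neg_ne_zero.2 (hn s hs)) h

theorem flux_image_eq {A : Set ℝ} {e : ℝ → ℝ} (hA : MeasurableSet A) (he : Measurable e)
    (hei : InjOn e A) (hsm : ∀ s ∈ A ∪ e '' A, ContDiffAt ℝ 1 γ s)
    (hn : ∀ s ∈ A, normalComponent γ s v ≠ 0) (hω : ∀ s ∈ A, ω v (γ (e s)) = ω v (γ s)) :
    flux γ v (e '' A) = flux γ v A := by
  simpa only [flux, abs_neg] using lintegral_abs_deriv_image_eq hA he hei
    (fun s hs ↦ (hasDerivAt_areaForm'_comp v (hsm s hs)).hasDerivWithinAt)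
    (fun s hs ↦ neg_ne_zero.2 (hn s hs)) hω

theorem volume_image_areaForm'_tangency (γ : ℝ → ℂ) (v : ℂ) :
    volume ((fun s ↦ ω v (γ s)) '' {s | ContDiffAt ℝ 1 γ s ∧ normalComponent γ s v = 0}) = 0 := by
  refine addHaar_image_eq_zero_of_det_fderivWithin_eq_zero volume
    (fun s hs ↦ (hasDerivAt_areaForm'_comp v hs.1).hasFDerivAt.hasFDerivWithinAt) fun s hs ↦ ?_
  rw [hs.2, neg_zero, ContinuousLinearMap.toSpanSingleton_zero]
  simp

namespace IsBoundaryParam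

theorem finite_not_contDiffAt (hγ : IsBoundaryParam Ω L γ) :
    {s | s ∈ Ico 0 L ∧ ¬ContDiffAt ℝ 1 γ s}.Finite := by
  obtain ⟨vertices, hfin, hsmooth⟩ := hγ.piecewise_smooth
  have hvertices : (Ico 0 L ∩ γ ⁻¹' vertices).Finite :=
    .of_injOn (f := γ) (fun _ hs ↦ hs.2) (hγ.injOn.mono inter_subset_left) hfin
  refine hvertices.subset fun s ⟨hs, hns⟩ ↦ ⟨hs, by_contra fun hv ↦ hns ?_⟩
  obtain ⟨ε, hε, hball⟩ := Metric.isOpen_iff.1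
    (hfin.isClosed.isOpen_compl.preimage hγ.continuous) s hv
  rw [Real.ball_eq_Ioo] at hball
  exact (hsmooth (s - ε) (s + ε) (by linarith) fun x hx ↦ hball hx).contDiffAt
    (Icc_mem_nhds (by linarith) (by linarith))

theorem flux_eq_zero_of_disjoint_mapDomain (hγ : IsBoundaryParam Ω L γ) (hopen : IsOpen Ω)
    (hbdd : Bornology.IsBounded Ω) (hv : ‖v‖ = 1) {A : Set ℝ} (hA : MeasurableSet A)
    (hAL : A ⊆ Ico 0 L) (hsm : ∀ s ∈ A, ContDiffAt ℝ 1 γ s)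
    (hn : ∀ s ∈ A, 0 < normalComponent γ s v) (hD : ∀ s ∈ A, phasePoint γ v s ∉ mapDomain Ω L γ) :
    flux γ v A = 0 := by
  refine flux_eq_zero_of_volume_image_eq_zero hA hsm (fun s hs ↦ (hn s hs).ne') ?_
  have hvertices : volume ((fun s ↦ ω v (γ s)) '' {s | s ∈ Ico 0 L ∧ ¬ContDiffAt ℝ 1 γ s}) = 0 :=
    (hγ.finite_not_contDiffAt.image _).measure_zero _
  refine measure_mono_null ?_ (measure_union_null hvertices (volume_image_areaForm'_tangency γ v))
  rintro _ ⟨s, hs, rfl⟩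
  by_contra hreg
  refine hD s hs (hγ.phasePoint_mem_mapDomain hopen hbdd hv (hAL hs) (hsm s hs) (hn s hs)
    fun s' hs' heq ↦ ?_)
  have hsmooth : ContDiffAt ℝ 1 γ s' := by
    by_contra h
    exact hreg (Or.inl ⟨s', ⟨hs', h⟩, heq⟩)
  exact ⟨hsmooth, fun h ↦ hreg (Or.inr ⟨s', ⟨hsmooth, h⟩, heq⟩)⟩

end IsBoundaryParam

end BoundaryGeometry

/-! ### Disintegration of the Liouville measure over directions -/

section Liouville

theorem lintegral_comp_add_of_periodic {g : ℝ → ENNReal} {T : ℝ} (hT : 0 < T)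
    (hg : Function.Periodic g T) (a t : ℝ) :
    ∫⁻ x in Ioc t (t + T), g (x + a) = ∫⁻ x in Ioc t (t + T), g x := by
  have : Fact (0 < T) := ⟨hT⟩
  calc ∫⁻ x in Ioc t (t + T), g (x + a)
      = ∫⁻ x in Ioc t (t + T), hg.lift (x + a : AddCircle T) :=
        lintegral_congr fun x ↦ (hg.lift_coe (x + a)).symm
    _ = ∫⁻ b : AddCircle T, hg.lift (b + a) :=
        AddCircle.lintegral_preimage T t fun b ↦ hg.lift (b + a)
    _ = ∫⁻ b : AddCircle T, hg.lift b := lintegral_add_right_eq_self hg.lift (a : AddCircle T)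
    _ = ∫⁻ x in Ioc t (t + T), g x := (AddCircle.lintegral_preimage T t hg.lift).symm

theorem lintegral_exp_mul_of_norm_eq_one (h : ℂ → ENNReal) {c : ℂ} (hc : ‖c‖ = 1) :
    ∫⁻ ψ : ℝ in Ioc (-Real.pi) Real.pi, h (c * Complex.exp (ψ * Complex.I)) =
      ∫⁻ ψ : ℝ in Ioc (-Real.pi) Real.pi, h (Complex.exp (ψ * Complex.I)) := by
  have hpolar := Complex.norm_mul_exp_arg_mul_I c
  rw [hc, Complex.ofReal_one, one_mul] at hpolar
  have hperiodic : Function.Periodic (fun ψ : ℝ ↦ h (Complex.exp (ψ * Complex.I)))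
      (2 * Real.pi) := fun ψ ↦ by
    simp only [Complex.ofReal_add, Complex.ofReal_mul, Complex.ofReal_ofNat, add_mul,
      Complex.exp_periodic _]
  have hshift := lintegral_comp_add_of_periodic Real.two_pi_pos hperiodic c.arg (-Real.pi)
  rw [show -Real.pi + 2 * Real.pi = Real.pi by ring] at hshift
  rw [← hshift]
  simp only [Complex.ofReal_add, add_mul, Complex.exp_add, hpolar, mul_comm c]

theorem setLIntegral_Icc_mul_sin_eq (G : ℝ → ENNReal) {c : ℂ} (hc : ‖c‖ = 1) :
    ∫⁻ θ in Icc 0 Real.pi, G θ * ENNReal.ofReal (Real.sin θ) =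
      ∫⁻ ψ : ℝ in Ioc (-Real.pi) Real.pi, G (c * Complex.exp (ψ * Complex.I)).arg *
        ENNReal.ofReal (c * Complex.exp (ψ * Complex.I)).im := by
  rw [lintegral_exp_mul_of_norm_eq_one (fun w ↦ G w.arg * ENNReal.ofReal w.im) hc]
  have harg : ∀ ψ ∈ Ioc (-Real.pi) Real.pi, (Complex.exp (ψ * Complex.I)).arg = ψ := fun ψ hψ ↦ by
    rw [Complex.exp_mul_I, Complex.arg_cos_add_sin_mul_I hψ]
  have hlower : ∫⁻ θ in Ioc (-Real.pi) 0, G θ * ENNReal.ofReal (Real.sin θ) = 0 :=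
    setLIntegral_eq_zero measurableSet_Ioc fun θ hθ ↦ by
      rw [ENNReal.ofReal_of_nonpos (Real.sin_nonpos_of_nonpos_of_neg_pi_le hθ.2 hθ.1.le), mul_zero,
        Pi.zero_apply]
  calc ∫⁻ θ in Icc 0 Real.pi, G θ * ENNReal.ofReal (Real.sin θ)
      = ∫⁻ θ in Ioc 0 Real.pi, G θ * ENNReal.ofReal (Real.sin θ) :=
        setLIntegral_congr Ioc_ae_eq_Icc.symm
    _ = ∫⁻ θ in Ioc (-Real.pi) 0 ∪ Ioc 0 Real.pi, G θ * ENNReal.ofReal (Real.sin θ) := by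
        rw [lintegral_union measurableSet_Ioc (Ioc_disjoint_Ioc_of_le le_rfl), hlower, zero_add]
    _ = _ := by
        rw [Ioc_union_Ioc_eq_Ioc (neg_nonpos.2 Real.pi_pos.le) Real.pi_pos.le]
        refine setLIntegral_congr_fun measurableSet_Ioc fun ψ hψ ↦ ?_
        simp only [harg ψ hψ, Complex.exp_ofReal_mul_I_im]

theorem lintegral_liouville (L : ℝ) {F : ℝ × ℝ → ENNReal} (hF : Measurable F) :
    ∫⁻ z, F z ∂liouville L = ∫⁻ s in Ico 0 L, ∫⁻ θ in Icc 0 Real.pi,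
      F (s, θ) * ENNReal.ofReal (Real.sin θ) := by
  have hsin : Measurable fun z : ℝ × ℝ ↦ ENNReal.ofReal (Real.sin z.2) := by fun_prop
  rw [liouville, lintegral_withDensity_eq_lintegral_mul _ hsin hF, phaseSpace,
    Measure.volume_eq_prod, ← Measure.prod_restrict, lintegral_prod _ (hsin.mul hF).aemeasurable]
  simp only [Pi.mul_apply, mul_comm]

theorem measurable_normalComponent (γ : ℝ → ℂ) :
    Measurable fun q : ℝ × ℂ ↦ normalComponent γ q.1 q.2 := by
  have := measurable_deriv γ
  simp only [normalComponent_apply]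
  fun_prop

theorem measurable_phasePoint (γ : ℝ → ℂ) :
    Measurable fun q : ℝ × ℂ ↦ phasePoint γ q.2 q.1 := by
  have := measurable_deriv γ
  unfold phasePoint
  fun_prop

namespace IsBoundaryParam

theorem ae_contDiffAt (hγ : IsBoundaryParam Ω L γ) :
    ∀ᵐ s ∂volume.restrict (Ico 0 L), ContDiffAt ℝ 1 γ s := by
  rw [ae_restrict_iff' measurableSet_Ico, ae_iff]
  simp only [Classical.not_imp]
  exact hγ.finite_not_contDiffAt.measure_zero _

theorem lintegral_liouville_eq_lintegral_direction (hγ : IsBoundaryParam Ω L γ)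
    {F : ℝ × ℝ → ENNReal} (hF : Measurable F) :
    ∫⁻ z, F z ∂liouville L = ∫⁻ ψ : ℝ in Ioc (-Real.pi) Real.pi, ∫⁻ s in Ico 0 L,
      F (phasePoint γ (Complex.exp (ψ * Complex.I)) s) *
        ENNReal.ofReal (normalComponent γ s (Complex.exp (ψ * Complex.I))) := by
  have hdir : Measurable fun q : ℝ × ℝ ↦ (q.1, Complex.exp (q.2 * Complex.I)) := by fun_prop
  rw [lintegral_liouville L hF]
  refine (lintegral_congr_ae (hγ.ae_contDiffAt.mono fun s hs ↦ ?_)).trans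
    (lintegral_lintegral_swap ((hF.comp ((measurable_phasePoint γ).comp hdir)).mul
      ((measurable_normalComponent γ).comp hdir).ennreal_ofReal).aemeasurable)
  simp only [normalComponent_apply, phasePoint]
  exact setLIntegral_Icc_mul_sin_eq (fun θ ↦ F (s, θ))
    (by rw [RCLike.norm_conj, hγ.unit_speed s hs])

end IsBoundaryParam

/-- The footpoints of the phase points of `B` with outgoing velocity `v`. -/
def directionSlice (L : ℝ) (γ : ℝ → ℂ) (B : Set (ℝ × ℝ)) (v : ℂ) : Set ℝ :=
  {s | s ∈ Ico 0 L ∧ ContDiffAt ℝ 1 γ s ∧ 0 < normalComponent γ s v ∧ phasePoint γ v s ∈ B}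

theorem measurableSet_directionSlice {B : Set (ℝ × ℝ)} (hB : MeasurableSet B) (v : ℂ) :
    MeasurableSet (directionSlice L γ B v) :=
  measurableSet_Ico.inter ((isOpen_setOf_contDiffAt γ).measurableSet.inter
    ((measurableSet_lt measurable_const
      ((measurable_normalComponent γ).comp measurable_prodMk_right)).inter
      (hB.preimage ((measurable_phasePoint γ).comp measurable_prodMk_right))))

namespace IsBoundaryParam

theorem lintegral_indicator_phasePoint (hγ : IsBoundaryParam Ω L γ) {B : Set (ℝ × ℝ)}
    (hB : MeasurableSet B) (v : ℂ) :
    ∫⁻ s in Ico 0 L, B.indicator 1 (phasePoint γ v s) * ENNReal.ofReal (normalComponent γ s v) =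
      flux γ v (directionSlice L γ B v) := by
  have hsub : directionSlice L γ B v ⊆ Ico 0 L := fun s hs ↦ hs.1
  rw [flux, ← inter_eq_left.2 hsub, ← setLIntegral_indicator (measurableSet_directionSlice hB v)]
  refine lintegral_congr_ae ?_
  filter_upwards [hγ.ae_contDiffAt, ae_restrict_mem measurableSet_Ico] with s hs hsL
  by_cases hn : 0 < normalComponent γ s v
  · have hmem : s ∈ directionSlice L γ B v ↔ phasePoint γ v s ∈ B :=
      ⟨fun h ↦ h.2.2.2, fun h ↦ ⟨hsL, hs, hn, h⟩⟩
    by_cases hsB : phasePoint γ v s ∈ B <;> simp [hmem, hsB, abs_of_pos hn]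
  · rw [ENNReal.ofReal_of_nonpos (not_lt.1 hn), mul_zero,
      indicator_of_notMem fun h : s ∈ directionSlice L γ B v ↦ hn h.2.2.1]

theorem liouville_apply (hγ : IsBoundaryParam Ω L γ) {B : Set (ℝ × ℝ)} (hB : MeasurableSet B) :
    liouville L B = ∫⁻ ψ : ℝ in Ioc (-Real.pi) Real.pi,
      flux γ (Complex.exp (ψ * Complex.I))
        (directionSlice L γ B (Complex.exp (ψ * Complex.I))) := by
  rw [← lintegral_indicator_one hB,
    hγ.lintegral_liouville_eq_lintegral_direction (measurable_one.indicator hB)]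
  simp only [hγ.lintegral_indicator_phasePoint hB]

theorem ae_mem_mapDomain (hγ : IsBoundaryParam Ω L γ) (hopen : IsOpen Ω)
    (hbdd : Bornology.IsBounded Ω) : ∀ᵐ z ∂liouville L, z ∈ mapDomain Ω L γ := by
  have hD := (hγ.measurableSet_mapDomain hopen).compl
  rw [ae_iff, ← compl_def, hγ.liouville_apply hD]
  refine (lintegral_congr fun ψ ↦ ?_).trans lintegral_zero
  exact hγ.flux_eq_zero_of_disjoint_mapDomain hopen hbdd (Complex.norm_exp_ofReal_mul_I ψ)
    (measurableSet_directionSlice hD _) (fun _ hs ↦ hs.1) (fun _ hs ↦ hs.2.1)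
    (fun _ hs ↦ hs.2.2.1) fun _ hs ↦ hs.2.2.2

end IsBoundaryParam

end Liouville

/-! ### Invariance of the Liouville measure -/

section Invariance

attribute [local instance] Complex.finrank_real_complex_fact

variable {B : Set (ℝ × ℝ)} {s : ℝ} {v : ℂ}

/-- The billiard map followed by time reversal, which is an involution because the reversed ball
retraces the trajectory. -/
noncomputable def returnMap (Ω : Set ℂ) (L : ℝ) (γ : ℝ → ℂ) : ℝ × ℝ → ℝ × ℝ :=
  reversal ∘ billiardMap Ω L γ

/-- The footpoint of the first collision of the ball that leaves the boundary point `s` with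
velocity `v`. -/
noncomputable def returnFootpoint (Ω : Set ℂ) (L : ℝ) (γ : ℝ → ℂ) (v : ℂ) (s : ℝ) : ℝ :=
  (returnMap Ω L γ (phasePoint γ v s)).1

theorem mapDomain_subset_smoothPhase : mapDomain Ω L γ ⊆ smoothPhase L γ :=
  fun _ ⟨_, h⟩ ↦ h.1

theorem step_returnMap (hz : z ∈ mapDomain Ω L γ) :
    Step Ω L γ (returnMap Ω L γ z) (reversal z) :=
  (step_billiardMap hz).reverse

theorem returnMap_mem_mapDomain (hz : z ∈ mapDomain Ω L γ) :
    returnMap Ω L γ z ∈ mapDomain Ω L γ :=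
  ⟨_, step_returnMap hz⟩

theorem outVelocity_returnMap (hz : z ∈ mapDomain Ω L γ) :
    outVelocity γ (returnMap Ω L γ z) = -outVelocity γ z := by
  rw [returnMap, Function.comp_apply, outVelocity_reversal, (step_billiardMap hz).2.2.2]

theorem areaForm'_returnMap (hz : z ∈ mapDomain Ω L γ) :
    Complex.orientation.areaForm' (outVelocity γ z) (γ (returnMap Ω L γ z).1) =
      Complex.orientation.areaForm' (outVelocity γ z) (γ z.1) := by
  obtain ⟨-, -, ⟨t, -, hγt, -⟩, -⟩ := step_billiardMap hz
  rw [returnMap, Function.comp_apply, reversal_fst, hγt, map_add, ← Complex.real_smul, map_smul]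
  simp

namespace IsBoundaryParam

theorem measurable_returnMap (hγ : IsBoundaryParam Ω L γ) (hopen : IsOpen Ω) :
    Measurable (returnMap Ω L γ) :=
  measurable_reversal.comp (hγ.measurable_billiardMap hopen)

theorem returnMap_returnMap (hγ : IsBoundaryParam Ω L γ) (hopen : IsOpen Ω)
    (hz : z ∈ mapDomain Ω L γ) : returnMap Ω L γ (returnMap Ω L γ z) = z := by
  have h := congrArg reversal (hγ.billiardMap_eq hopen (step_returnMap hz))
  rwa [reversal_involutive] at h

theorem phasePoint_neg_returnFootpoint (hγ : IsBoundaryParam Ω L γ) (hv : ‖v‖ = 1)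
    (hs : ContDiffAt ℝ 1 γ s) (hD : phasePoint γ v s ∈ mapDomain Ω L γ) :
    phasePoint γ (-v) (returnFootpoint Ω L γ v s) =
      returnMap Ω L γ (phasePoint γ v s) := by
  have h := hγ.phasePoint_outVelocity
    (mapDomain_subset_smoothPhase (returnMap_mem_mapDomain hD))
  rwa [outVelocity_returnMap hD, hγ.outVelocity_phasePoint hv hs] at h

theorem mapsTo_directionSlice_returnFootpoint (hγ : IsBoundaryParam Ω L γ) (hv : ‖v‖ = 1)
    (B : Set (ℝ × ℝ)) :
    MapsTo (returnFootpoint Ω L γ v)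
      (directionSlice L γ (returnMap Ω L γ ⁻¹' B ∩ mapDomain Ω L γ) v)
      (directionSlice L γ (B ∩ mapDomain Ω L γ) (-v)) := by
  rintro s ⟨-, hs, -, hB, hD⟩
  have hr := mapDomain_subset_smoothPhase (returnMap_mem_mapDomain hD)
  refine ⟨hr.1, hr.2.1, ?_, ?_⟩
  · have hn := hγ.normalComponent_outVelocity hr.2.1
    rw [outVelocity_returnMap hD, hγ.outVelocity_phasePoint hv hs] at hn
    exact hn ▸ Real.sin_pos_of_mem_Ioo hr.2.2
  · rw [hγ.phasePoint_neg_returnFootpoint hv hs hD]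
    exact ⟨hB, returnMap_mem_mapDomain hD⟩

theorem leftInvOn_directionSlice_returnFootpoint (hγ : IsBoundaryParam Ω L γ) (hopen : IsOpen Ω)
    (hv : ‖v‖ = 1) (hB : B ⊆ mapDomain Ω L γ) :
    LeftInvOn (returnFootpoint Ω L γ (-v))
      (returnFootpoint Ω L γ v) (directionSlice L γ B v) := by
  rintro s ⟨-, hs, -, hsB⟩
  rw [returnFootpoint, hγ.phasePoint_neg_returnFootpoint hv hs (hB hsB),
    hγ.returnMap_returnMap hopen (hB hsB), phasePoint]

theorem bijOn_directionSlice_returnFootpoint (hγ : IsBoundaryParam Ω L γ) (hopen : IsOpen Ω)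
    (hv : ‖v‖ = 1) (B : Set (ℝ × ℝ)) :
    BijOn (returnFootpoint Ω L γ v)
      (directionSlice L γ (returnMap Ω L γ ⁻¹' B ∩ mapDomain Ω L γ) v)
      (directionSlice L γ (B ∩ mapDomain Ω L γ) (-v)) := by
  have hv' : ‖-v‖ = 1 := by rwa [norm_neg]
  have hback := hγ.mapsTo_directionSlice_returnFootpoint hv' (returnMap Ω L γ ⁻¹' B)
  have hright := hγ.leftInvOn_directionSlice_returnFootpoint hopen hv'
    (inter_subset_right : B ∩ mapDomain Ω L γ ⊆ _)
  have hinvol : returnMap Ω L γ ⁻¹' (returnMap Ω L γ ⁻¹' B) ∩ mapDomain Ω L γ =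
      B ∩ mapDomain Ω L γ := by
    ext z
    refine and_congr_left fun hz ↦ ?_
    rw [mem_preimage, mem_preimage, hγ.returnMap_returnMap hopen hz]
  rw [neg_neg] at hback hright
  rw [hinvol] at hback
  exact InvOn.bijOn
    ⟨hγ.leftInvOn_directionSlice_returnFootpoint hopen hv inter_subset_right, hright⟩
    (hγ.mapsTo_directionSlice_returnFootpoint hv B) hback

theorem flux_directionSlice_preimage_returnMap (hγ : IsBoundaryParam Ω L γ) (hopen : IsOpen Ω)
    (hv : ‖v‖ = 1) (hB : MeasurableSet B) :
    flux γ v (directionSlice L γ (returnMap Ω L γ ⁻¹' B ∩ mapDomain Ω L γ) v) =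
      flux γ (-v) (directionSlice L γ (B ∩ mapDomain Ω L γ) (-v)) := by
  have hr := hγ.measurable_returnMap hopen
  have hbij := hγ.bijOn_directionSlice_returnFootpoint hopen hv B
  rw [flux_neg, ← hbij.image_eq]
  have hfoot : Measurable (returnFootpoint Ω L γ v) :=
    measurable_fst.comp (hr.comp ((measurable_phasePoint γ).comp measurable_prodMk_right))
  refine (flux_image_eq (measurableSet_directionSlice
    ((hB.preimage hr).inter (hγ.measurableSet_mapDomain hopen)) v) hfoot hbij.injOn ?_
    (fun s hs ↦ hs.2.2.1.ne') ?_).symm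
  · rw [hbij.image_eq]
    exact fun s hs ↦ hs.elim (fun h ↦ h.2.1) fun h ↦ h.2.1
  · rintro s ⟨-, hs, -, -, hD⟩
    have h := areaForm'_returnMap hD
    rwa [hγ.outVelocity_phasePoint hv hs] at h

theorem liouville_preimage_returnMap (hγ : IsBoundaryParam Ω L γ) (hopen : IsOpen Ω)
    (hB : MeasurableSet B) :
    liouville L (returnMap Ω L γ ⁻¹' B ∩ mapDomain Ω L γ) =
      liouville L (B ∩ mapDomain Ω L γ) := by
  have hD := hγ.measurableSet_mapDomain hopen
  rw [hγ.liouville_apply (hB.inter hD),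
    hγ.liouville_apply ((hB.preimage (hγ.measurable_returnMap hopen)).inter hD),
    ← lintegral_exp_mul_of_norm_eq_one (c := -1)
      (fun v ↦ flux γ v (directionSlice L γ (B ∩ mapDomain Ω L γ) v)) (by simp)]
  refine lintegral_congr fun ψ ↦ ?_
  rw [neg_one_mul]
  exact hγ.flux_directionSlice_preimage_returnMap hopen (Complex.norm_exp_ofReal_mul_I ψ) hB

theorem measurePreserving_returnMap (hγ : IsBoundaryParam Ω L γ) (hopen : IsOpen Ω)
    (hbdd : Bornology.IsBounded Ω) :
    MeasurePreserving (returnMap Ω L γ) (liouville L) (liouville L) := by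
  have hconull : liouville L (mapDomain Ω L γ)ᶜ = 0 := mem_ae_iff.1 (hγ.ae_mem_mapDomain hopen hbdd)
  refine ⟨hγ.measurable_returnMap hopen, Measure.ext fun B hB ↦ ?_⟩
  rw [Measure.map_apply (hγ.measurable_returnMap hopen) hB, ← measure_inter_conull hconull,
    hγ.liouville_preimage_returnMap hopen hB, measure_inter_conull hconull]

end IsBoundaryParam

theorem measurePreserving_reversal (L : ℝ) :
    MeasurePreserving reversal (liouville L) (liouville L) := by
  refine ⟨measurable_reversal, Measure.ext_of_lintegral _ fun F hF ↦ ?_⟩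
  rw [lintegral_map hF measurable_reversal, lintegral_liouville L hF,
    lintegral_liouville L (F := fun z ↦ F (reversal z)) (hF.comp measurable_reversal)]
  refine lintegral_congr fun s ↦ ?_
  have h := (Measure.measurePreserving_sub_left volume Real.pi).setLIntegral_comp_preimage_emb
    (Homeomorph.subLeft Real.pi).measurableEmbedding
    (fun θ ↦ F (s, θ) * ENNReal.ofReal (Real.sin θ)) (Icc 0 Real.pi)
  rw [preimage_const_sub_Icc, sub_self, sub_zero] at h
  simpa only [reversal, Real.sin_pi_sub] using h

theorem IsBoundaryParam.measurePreserving_billiardMap (hγ : IsBoundaryParam Ω L γ)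
    (hopen : IsOpen Ω) (hbdd : Bornology.IsBounded Ω) :
    MeasurePreserving (billiardMap Ω L γ) (liouville L) (liouville L) := by
  have h := (measurePreserving_reversal L).comp (hγ.measurePreserving_returnMap hopen hbdd)
  rwa [returnMap, ← Function.comp_assoc, reversal_involutive.comp_self] at h

end Invariance

/-! ### Rotation numbers -/

section LiouvilleMass

theorem lintegral_Icc_ofReal_sin :
    ∫⁻ θ in Icc 0 Real.pi, ENNReal.ofReal (Real.sin θ) = ENNReal.ofReal 2 := by
  rw [← ofReal_integral_eq_lintegral_ofReal Real.continuous_sin.continuousOn.integrableOn_Icc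
    (ae_restrict_of_forall_mem measurableSet_Icc fun θ hθ ↦ Real.sin_nonneg_of_mem_Icc hθ),
    integral_Icc_eq_integral_Ioc, ← intervalIntegral.integral_of_le Real.pi_pos.le, integral_sin,
    Real.cos_zero, Real.cos_pi, sub_neg_eq_add, one_add_one_eq_two]

theorem liouville_univ (L : ℝ) : liouville L univ = ENNReal.ofReal (2 * L) := by
  rw [← lintegral_one, lintegral_liouville L measurable_const]
  simp only [one_mul, lintegral_Icc_ofReal_sin, setLIntegral_const, Real.volume_Ico, sub_zero,
    ENNReal.ofReal_mul zero_le_two]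

instance isFiniteMeasure_liouville (L : ℝ) : IsFiniteMeasure (liouville L) :=
  ⟨liouville_univ L ▸ ENNReal.ofReal_lt_top⟩

theorem restrict_liouville_phaseSpace (L : ℝ) :
    (liouville L).restrict (phaseSpace L) = liouville L :=
  Measure.restrict_eq_self_of_ae_mem <| (withDensity_absolutelyContinuous _ _).ae_le
    (ae_restrict_mem (measurableSet_Ico.prod measurableSet_Icc))

theorem measureReal_liouville_univ (hL : 0 ≤ L) : (liouville L).real univ = 2 * L := by
  rw [measureReal_def, liouville_univ, ENNReal.toReal_ofReal (by positivity)]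

theorem measureReal_liouville_phaseSpace (hL : 0 ≤ L) :
    (liouville L).real (phaseSpace L) = 2 * L := by
  rw [← measureReal_restrict_apply_univ, restrict_liouville_phaseSpace,
    measureReal_liouville_univ hL]

end LiouvilleMass

section RotationNumber

variable {s₁ s₂ : ℝ}

theorem increment_mem_Icc (h₁ : s₁ ∈ Ico 0 L) (h₂ : s₂ ∈ Ico 0 L) :
    increment L s₁ s₂ ∈ Icc 0 L := by
  unfold increment
  split_ifs with h
  · exact ⟨by linarith, by linarith [h₁.1, h₂.2]⟩
  · exact ⟨by linarith [h₁.2, h₂.1], by linarith⟩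

theorem increment_swap (h : s₁ ≠ s₂) : increment L s₂ s₁ = L - increment L s₁ s₂ := by
  unfold increment
  rcases h.lt_or_gt with h | h
  · rw [if_neg h.not_ge, if_pos h.le]
    ring
  · rw [if_pos h.le, if_neg h.not_ge]
    ring

theorem averageIncrement_eq_birkhoffAverage (Ω : Set ℂ) (L : ℝ) (γ : ℝ → ℂ) (z : ℝ × ℝ) :
    averageIncrement Ω L γ z =
      fun n ↦ birkhoffAverage ℝ (billiardMap Ω L γ) (footpointIncrement Ω L γ) n z :=
  funext fun _ ↦ div_eq_inv_mul _ _

theorem averageIncrement_div_eq_birkhoffAverage (Ω : Set ℂ) (L : ℝ) (γ : ℝ → ℂ) (z : ℝ × ℝ)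
    (n : ℕ) : averageIncrement Ω L γ z n / L =
      birkhoffAverage ℝ (billiardMap Ω L γ) (fun w ↦ footpointIncrement Ω L γ w / L) n z := by
  rw [averageIncrement, birkhoffAverage, birkhoffSum, ← Finset.sum_div, smul_eq_mul]
  ring

theorem tendsto_birkhoffAverage_rotationNumber (hz : z ∈ rotationDomain Ω L γ) :
    Tendsto (fun n ↦ birkhoffAverage ℝ (billiardMap Ω L γ)
      (fun w ↦ footpointIncrement Ω L γ w / L) n z) atTop (𝓝 (rotationNumber Ω L γ z)) := by
  simp only [← averageIncrement_div_eq_birkhoffAverage]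
  exact (tendsto_nhds_limUnder hz.2).div_const L

theorem image_one_sub_eq_preimage (X : Set ℝ) :
    (fun x ↦ 1 - x) '' X = (fun x ↦ 1 - x) ⁻¹' X :=
  congrFun (image_eq_preimage_of_inverse (sub_sub_cancel 1) (sub_sub_cancel 1)) X

namespace IsBoundaryParam

theorem footpointIncrement_mem_Icc (hγ : IsBoundaryParam Ω L γ) (z : ℝ × ℝ) :
    footpointIncrement Ω L γ z ∈ Icc 0 L := by
  by_cases hz : z ∈ mapDomain Ω L γ
  · have hstep := step_billiardMap hz
    exact increment_mem_Icc hstep.1.1 hstep.2.1.1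
  · rw [footpointIncrement, billiardMap_of_notMem hz, increment, if_pos le_rfl, sub_self]
    exact ⟨le_rfl, hγ.perimeter_pos.le⟩

theorem averageIncrement_mem_Icc (hγ : IsBoundaryParam Ω L γ) (z : ℝ × ℝ) (n : ℕ) :
    averageIncrement Ω L γ z n ∈ Icc 0 L := by
  refine ⟨div_nonneg (Finset.sum_nonneg fun k _ ↦ (hγ.footpointIncrement_mem_Icc _).1)
    n.cast_nonneg, div_le_of_le_mul₀ n.cast_nonneg hγ.perimeter_pos.le ?_⟩
  simpa [mul_comm] using Finset.sum_le_card_nsmul (Finset.range n) _ L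
    fun k _ ↦ (hγ.footpointIncrement_mem_Icc ((billiardMap Ω L γ)^[k] z)).2

theorem measurable_footpointIncrement (hγ : IsBoundaryParam Ω L γ) (hopen : IsOpen Ω) :
    Measurable (footpointIncrement Ω L γ) := by
  have hfoot : Measurable fun z ↦ (billiardMap Ω L γ z).1 :=
    measurable_fst.comp (hγ.measurable_billiardMap hopen)
  exact Measurable.ite (measurableSet_le measurable_fst hfoot) (hfoot.sub measurable_fst)
    ((hfoot.add_const L).sub measurable_fst)

theorem footpointIncrement_reversal_billiardMap (hγ : IsBoundaryParam Ω L γ) (hopen : IsOpen Ω)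
    (hz : z ∈ mapDomain Ω L γ) :
    footpointIncrement Ω L γ (reversal (billiardMap Ω L γ z)) =
      L - footpointIncrement Ω L γ z := by
  have hstep := step_billiardMap hz
  rw [footpointIncrement, hγ.billiardMap_eq hopen hstep.reverse]
  exact increment_swap fun h ↦ (hγ.step_iff.1 hstep).2.2.1 (congrArg γ h)

theorem measurable_averageIncrement (hγ : IsBoundaryParam Ω L γ) (hopen : IsOpen Ω) (n : ℕ) :
    Measurable fun z ↦ averageIncrement Ω L γ z n := by
  simp only [averageIncrement_eq_birkhoffAverage]
  exact measurable_birkhoffAverage (hγ.measurable_billiardMap hopen)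
    (hγ.measurable_footpointIncrement hopen) n

theorem measurable_rotationNumber (hγ : IsBoundaryParam Ω L γ) (hopen : IsOpen Ω) :
    Measurable (rotationNumber Ω L γ) :=
  (StronglyMeasurable.limUnder (l := atTop) fun n ↦
    (hγ.measurable_averageIncrement hopen n).stronglyMeasurable).measurable.div_const L

theorem measurableSet_rotationDomain (hγ : IsBoundaryParam Ω L γ) (hopen : IsOpen Ω) :
    MeasurableSet (rotationDomain Ω L γ) := by
  rw [rotationDomain, ofPred_and, ofPred_forall]
  exact (MeasurableSet.iInter fun k ↦
    (hγ.measurable_billiardMap hopen).iterate k (hγ.measurableSet_mapDomain hopen)).inter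
      (measurableSet_exists_tendsto (hγ.measurable_averageIncrement hopen))

theorem measurableSet_rotationPreimage (hγ : IsBoundaryParam Ω L γ) (hopen : IsOpen Ω)
    {X : Set ℝ} (hX : MeasurableSet X) : MeasurableSet (rotationPreimage Ω L γ X) :=
  (hγ.measurableSet_rotationDomain hopen).inter (hγ.measurable_rotationNumber hopen hX)

theorem ae_mem_rotationDomain (hγ : IsBoundaryParam Ω L γ) (hopen : IsOpen Ω)
    (hbdd : Bornology.IsBounded Ω) : ∀ᵐ z ∂liouville L, z ∈ rotationDomain Ω L γ := by
  have hφ := hγ.measurePreserving_billiardMap hopen hbdd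
  have horbit : ∀ᵐ z ∂liouville L, ∀ k, (billiardMap Ω L γ)^[k] z ∈ mapDomain Ω L γ :=
    ae_all_iff.2 fun k ↦ (hφ.iterate k).quasiMeasurePreserving.ae (hγ.ae_mem_mapDomain hopen hbdd)
  have hint : Integrable (footpointIncrement Ω L γ) (liouville L) :=
    .of_mem_Icc 0 L (hγ.measurable_footpointIncrement hopen).aemeasurable
      (.of_forall hγ.footpointIncrement_mem_Icc)
  filter_upwards [horbit, ae_exists_tendsto_birkhoffAverage hφ hint] with z hz hlim
  exact ⟨hz, by rwa [averageIncrement_eq_birkhoffAverage]⟩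

theorem rotationNumber_mem_Icc (hγ : IsBoundaryParam Ω L γ) (hz : z ∈ rotationDomain Ω L γ) :
    rotationNumber Ω L γ z ∈ Icc 0 1 := by
  have hlim : limUnder atTop (averageIncrement Ω L γ z) ∈ Icc 0 L :=
    isClosed_Icc.mem_of_tendsto (tendsto_nhds_limUnder hz.2)
      (.of_forall (hγ.averageIncrement_mem_Icc z))
  exact ⟨div_nonneg hlim.1 hγ.perimeter_pos.le, div_le_one_of_le₀ hlim.2 hγ.perimeter_pos.le⟩

theorem map_rotationNumber (hγ : IsBoundaryParam Ω L γ) (hopen : IsOpen Ω)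
    (hbdd : Bornology.IsBounded Ω) :
    (liouville L).map (rotationNumber Ω L γ) =
      (liouville L).map fun z ↦ 1 - rotationNumber Ω L γ z := by
  have hD := hγ.ae_mem_mapDomain hopen hbdd
  refine map_eq_map_const_sub_of_reversible (hγ.measurePreserving_billiardMap hopen hbdd)
    (measurePreserving_reversal L) ((hγ.measurable_footpointIncrement hopen).div_const L)
    (hD.mono fun z hz ↦ ?_) (hD.mono fun z hz ↦ ?_)
    ((hγ.ae_mem_rotationDomain hopen hbdd).mono fun z ↦ tendsto_birkhoffAverage_rotationNumber)
  · exact hγ.billiardMap_eq hopen (step_billiardMap hz).reverse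
  · rw [hγ.footpointIncrement_reversal_billiardMap hopen hz, sub_div,
      div_self hγ.perimeter_pos.ne']

theorem liouville_rotationPreimage (hγ : IsBoundaryParam Ω L γ) (hopen : IsOpen Ω)
    (hbdd : Bornology.IsBounded Ω) (X : Set ℝ) :
    liouville L (rotationPreimage Ω L γ X) = liouville L (rotationNumber Ω L γ ⁻¹' X) :=
  measure_congr <| (hγ.ae_mem_rotationDomain hopen hbdd).mono fun _ hz ↦
    propext (and_iff_right hz)

theorem liouville_rotationPreimage_image_one_sub (hγ : IsBoundaryParam Ω L γ) (hopen : IsOpen Ω)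
    (hbdd : Bornology.IsBounded Ω) {X : Set ℝ} (hX : MeasurableSet X) :
    liouville L (rotationPreimage Ω L γ X) =
      liouville L (rotationPreimage Ω L γ ((fun x ↦ 1 - x) '' X)) := by
  have hρ := hγ.measurable_rotationNumber hopen
  rw [hγ.liouville_rotationPreimage hopen hbdd, hγ.liouville_rotationPreimage hopen hbdd,
    ← Measure.map_apply hρ hX, hγ.map_rotationNumber hopen hbdd,
    Measure.map_apply (hρ.const_sub 1) hX, image_one_sub_eq_preimage]
  rfl

theorem integrable_rotationNumber (hγ : IsBoundaryParam Ω L γ) (hopen : IsOpen Ω)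
    (hbdd : Bornology.IsBounded Ω) : Integrable (rotationNumber Ω L γ) (liouville L) :=
  .of_mem_Icc 0 1 (hγ.measurable_rotationNumber hopen).aemeasurable
    ((hγ.ae_mem_rotationDomain hopen hbdd).mono fun _ ↦ hγ.rotationNumber_mem_Icc)

theorem integral_rotationNumber (hγ : IsBoundaryParam Ω L γ) (hopen : IsOpen Ω)
    (hbdd : Bornology.IsBounded Ω) : ∫ z, rotationNumber Ω L γ z ∂liouville L = L := by
  rw [integral_eq_half_mul_of_map_eq_map_const_sub (hγ.integrable_rotationNumber hopen hbdd)
    (hγ.map_rotationNumber hopen hbdd), measureReal_liouville_univ hγ.perimeter_pos.le]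
  ring

theorem tendsto_averageIncrement_billiardMap_iff (hγ : IsBoundaryParam Ω L γ) (z : ℝ × ℝ)
    (υ : ℝ) : Tendsto (averageIncrement Ω L γ (billiardMap Ω L γ z)) atTop (𝓝 υ) ↔
      Tendsto (averageIncrement Ω L γ z) atTop (𝓝 υ) := by
  have hrange : Bornology.IsBounded (range (footpointIncrement Ω L γ)) :=
    (Metric.isBounded_Icc 0 L).subset (range_subset_iff.2 hγ.footpointIncrement_mem_Icc)
  have hsub := tendsto_birkhoffAverage_apply_sub_birkhoffAverage' ℝ hrange (billiardMap Ω L γ) z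
  simp only [averageIncrement_eq_birkhoffAverage]
  exact ⟨fun h ↦ by simpa using h.sub hsub, fun h ↦ by simpa using hsub.add h⟩

theorem rotationNumber_comp_billiardMap (hγ : IsBoundaryParam Ω L γ) :
    rotationNumber Ω L γ ∘ billiardMap Ω L γ = rotationNumber Ω L γ := by
  funext z
  -- Off `rotationDomain` both sides are the junk value of `limUnder`, which only depends on the
  -- (here empty) set of limits.
  have hlim := funext fun υ ↦ propext (hγ.tendsto_averageIncrement_billiardMap_iff z υ)
  exact congrArg (fun p ↦ Classical.epsilon p / L) hlim

theorem ae_rotationNumber_eq_half (hγ : IsBoundaryParam Ω L γ) (hopen : IsOpen Ω)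
    (hbdd : Bornology.IsBounded Ω) (herg : IsErgodicBilliard Ω L γ) :
    ∀ᵐ z ∂liouville L, rotationNumber Ω L γ z = 1 / 2 := by
  obtain ⟨c, hc⟩ := herg.ae_eq_const_of_ae_eq_comp (hγ.measurable_rotationNumber hopen)
    hγ.rotationNumber_comp_billiardMap
  have hmean : L = 2 * L * c := by
    have h := integral_congr_ae hc
    simpa only [hγ.integral_rotationNumber hopen hbdd, Function.const_apply, integral_const,
      measureReal_liouville_univ hγ.perimeter_pos.le, smul_eq_mul] using h
  have hhalf : c = 1 / 2 := by
    have hL := hγ.perimeter_pos.ne'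
    field_simp at hmean ⊢
    linarith
  exact hhalf ▸ hc

end IsBoundaryParam

end RotationNumber

end PlanarBilliard

theorem mainTheorem1 (Ω : Set ℂ) (L : ℝ) (γ : ℝ → ℂ)
    (hopen : IsOpen Ω) (hbdd : Bornology.IsBounded Ω) (hconn : IsConnected Ω)
    (hsimply : IsSimplyConnected Ω)
    (hγ : PlanarBilliard.IsBoundaryParam Ω L γ) :
    -- the rotation number exists almost everywhere
    (∀ᵐ z ∂(PlanarBilliard.liouville L), z ∈ PlanarBilliard.rotationDomain Ω L γ) ∧
    -- 1.
    (∀ X : Set ℝ, X ⊆ Set.Icc 0 1 → MeasurableSet X →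
      MeasurableSet (PlanarBilliard.rotationPreimage Ω L γ X) ∧
      MeasurableSet (PlanarBilliard.rotationPreimage Ω L γ ((fun x => 1 - x) '' X)) ∧
      PlanarBilliard.liouville L (PlanarBilliard.rotationPreimage Ω L γ X) =
        PlanarBilliard.liouville L
          (PlanarBilliard.rotationPreimage Ω L γ ((fun x => 1 - x) '' X))) ∧
    -- 2.
    (MeasureTheory.IntegrableOn (PlanarBilliard.rotationNumber Ω L γ)
        (PlanarBilliard.phaseSpace L) (PlanarBilliard.liouville L) ∧
      (∫ z in PlanarBilliard.phaseSpace L, PlanarBilliard.rotationNumber Ω L γ z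
          ∂(PlanarBilliard.liouville L)) /
        (PlanarBilliard.liouville L).real (PlanarBilliard.phaseSpace L) = 1 / 2) ∧
    -- 3.
    (PlanarBilliard.IsErgodicBilliard Ω L γ →
      ∀ᵐ z ∂(PlanarBilliard.liouville L), PlanarBilliard.rotationNumber Ω L γ z = 1 / 2) := by
  refine ⟨hγ.ae_mem_rotationDomain hopen hbdd, fun X _ hX ↦
    ⟨hγ.measurableSet_rotationPreimage hopen hX, hγ.measurableSet_rotationPreimage hopen ?_,
      hγ.liouville_rotationPreimage_image_one_sub hopen hbdd hX⟩,
    ⟨(hγ.integrable_rotationNumber hopen hbdd).integrableOn, ?_⟩,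
    hγ.ae_rotationNumber_eq_half hopen hbdd⟩
  · rw [PlanarBilliard.image_one_sub_eq_preimage]
    exact hX.preimage (measurable_id.const_sub 1)
  · have hL := hγ.perimeter_pos
    rw [PlanarBilliard.restrict_liouville_phaseSpace, hγ.integral_rotationNumber hopen hbdd,
      PlanarBilliard.measureReal_liouville_phaseSpace hL.le]
    field_simp
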